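/- \textbf{Setting.} Let $Q$ be a smooth $n$-dimensional manifold (Hausdorff, second countable, without boundary), $\mathcal G$ a smooth Riemannian metric on $Q$, $V\in C^\infty(Q)$ a potential and $f^1,\dots,f^m\in\Omega^1(Q)$ smooth one-forms. Let $\tau_Q:TQ\to Q$ be the projection, $L(v_q)=\tfrac12\mathcal G(v_q,v_q)-V(q)$, $E_L=\dot q^i\,\partial L/\partial\dot q^i-L$ the energy, $J=dq^i\otimes\partial/\partial\dot q^i$ the canonical almost tangent structure and $\omega_L=-d(J^*dL)$. Let $G$ be the vector field on $TQ$ with $i_G\omega_L=dE_L$, and $Y^a=\sharp_{\mathcal G}(f^a)$. Write $(f^a)^V=\tau_Q^*f^a$ and $X^V=X^i\,\partial/\partial\dot q^i$ for vertical lifts, let $\mathcal G^c=\dot q^k\frac{\partial\mathcal G_{ij}}{\partial q^k}dq^i\otimes dq^j+\mathcal G_{ij}\,dq^i\otimes d\dot q^j+\mathcal G_{ij}\,d\dot q^i\otimes dq^j$ be the complete lift of $\mathcal G$ to $TQ$, with $\flat_{\mathcal G^c}(\xi)=\mathcal G^c(\xi,\cdot)$ and $\sharp_{\mathcal G^c}=\flat_{\mathcal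 G^c}^{-1}$, and let $\mathcal F^V$ be the vertical lift to $TQ$ of the input distribution $\mathcal F=\mathrm{span}\{Y^1,\dots,Y^m\}$. A smooth feedback $u=(u_1,\dots,u_m):TQ\to\mathbb R^m$ gives the closed-loop vector field $\Gamma=G+u_a(Y^a)^V$ on $TQ$ (sum over $a=1,\dots,m$). A set $\mathcal M\subseteq TQ$ is \emph{invariant} under $\Gamma$ if every integral curve of $\Gamma$, defined on an open interval around $0$, that starts in $\mathcal M$ at time $0$ stays in $\mathcal M$. Let $\mathcal M\subseteq TQ$ be a closed embedded submanifold of codimension $m$ (for instance the zero set of a smooth map $\phi:TQ\to\mathbb R^m$ whose differential is surjective at every zero), and suppose that at every $x\in\mathcal M$ the subspaces $T_x\mathcal M$ and $\mathcal F^V_x$ of $T_x(TQ)$ are transversal: $T_x\mathcal M+\mathcal F^V_x=T_x(TQ)$ and $\dim T_x\mathcal M+\dim\mathcal F^V_x=2n$. A \emph{control law} is a map $\tau:\mathcal M\to\mathbb R^m$ that is the restriction to $\mathcal M$ of a smooth feedback on $TQ$ under whose closed-loop vector field $\mathcal M$ is invariant. \textbf{Theorem.} The equation $i_G\omega_L=dE_L$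 has a solution $G$, given by $G=\sharp_{\omega_L}(dE_L)$, and there is exactly one control law $\tau^*:\mathcal M\to\mathbb R^m$. For every smooth feedback $u:TQ\to\mathbb R^m$ with closed-loop vector field $\Gamma=G+u_a(Y^a)^V$ the following are equivalent: \begin{enumerate} \item $\mathcal M$ is invariant under $\Gamma$; \item at every point of $\mathcal M$, $\ i_\Gamma\omega_L-dE_L=-\tau^*_a\,(f^a)^V$ and $\Gamma$ is tangent to $\mathcal M$; \item at every point of $\mathcal M$, $\ i_\Gamma\omega_L-dE_L\in\flat_{\mathcal G^c}(\mathcal F^V)$ and $\Gamma$ is tangent to $\mathcal M$. \end{enumerate} Moreover, at every point of $TQ$, $\mathcal F^V=\mathrm{span}\{\sharp_{\mathcal G^c}((f^a)^V)\}$ and $\flat_{\mathcal G^c}(\mathcal F^V)=\mathrm{span}\{\flat_{\mathcal G^c}((Y^a)^V)\}=\mathrm{span}\{(f^a)^V\}$. -/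

import Mathlib

open Set Bundle
open scoped Manifold ContDiff Topology

noncomputable section

/-! ### Linear algebra -/

section LinearAlgebra

variable {V W W' : Type*}
  [AddCommGroup V] [Module ℝ V] [TopologicalSpace V] [IsTopologicalAddGroup V]
  [ContinuousSMul ℝ V]
  [NormedAddCommGroup W] [NormedSpace ℝ W] [NormedAddCommGroup W'] [NormedSpace ℝ W']

/-- The bilinear form `(v, v') ↦ B (S v) (T v')`. -/
def bilinPullback (B : W →L[ℝ] W' →L[ℝ] ℝ) (S : V →L[ℝ] W) (T : V →L[ℝ] W') :
    V →L[ℝ] V →L[ℝ] ℝ :=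
  (ContinuousLinearMap.precomp ℝ T) ∘L (B ∘L S)

/-- The musical isomorphism `♯`, inverse of `♭ : v ↦ B v ·`, of a nondegenerate bilinear form `B`
on a finite-dimensional space (by convention it is `0` if `B` is degenerate). -/
def sharp (B : V →L[ℝ] V →L[ℝ] ℝ) : (V →L[ℝ] ℝ) →L[ℝ] V :=
  B.inverse

/-- The derivative at `y`, in the direction `v`, of a family `B` of bilinear forms. -/
def bilinDirDeriv (B : W → W →L[ℝ] W →L[ℝ] ℝ) (y v : W) : W →L[ℝ] W →L[ℝ] ℝ :=
  fderiv ℝ B y v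

/-- Two subspaces of `V` are transversal if they span `V` and have complementary dimensions. -/
def Transversal (W₁ W₂ : Submodule ℝ V) : Prop :=
  W₁ ⊔ W₂ = ⊤ ∧ Module.finrank ℝ V = Module.finrank ℝ W₁ + Module.finrank ℝ W₂

end LinearAlgebra

/-! ### Forms, submanifolds and flows on a manifold without boundary -/

section Manifold

variable {F : Type*} [NormedAddCommGroup F] [NormedSpace ℝ F] {H : Type*} [TopologicalSpace H]
  (I : ModelWithCorners ℝ F H) {N : Type*} [TopologicalSpace N] [ChartedSpace H N]

/-- The local representative of a one-form `α` in the preferred chart around `x`: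
its pullback by the inverse of the chart. -/
def oneFormInChart (α : ∀ y : N, TangentSpace I y →L[ℝ] ℝ) (x : N) : F → F →L[ℝ] ℝ :=
  fun y => (α ((extChartAt I x).symm y)) ∘L (mfderiv 𝓘(ℝ, F) I (extChartAt I x).symm y)

/-- The exterior derivative of a one-form, computed in the preferred chart around `x`:
`dα = (∂ᵢ αⱼ - ∂ⱼ αᵢ) dxⁱ ⊗ dxʲ`, that is `dα (v, w) = (D_v α) w - (D_w α) v`. -/
def oneFormExtDeriv (α : ∀ y : N, TangentSpace I y →L[ℝ] ℝ) (x : N) :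
    TangentSpace I x →L[ℝ] TangentSpace I x →L[ℝ] ℝ :=
  let D : F →L[ℝ] F →L[ℝ] ℝ := fderiv ℝ (oneFormInChart I α x) (extChartAt I x x)
  let P : TangentSpace I x →L[ℝ] F := mfderiv I 𝓘(ℝ, F) (extChartAt I x) x
  bilinPullback (D - D.flip) P P

/-- `M` is a closed embedded smooth submanifold of codimension `k`: it is closed and, around each of
its points, it is the zero set of a smooth map to `ℝᵏ` which is a submersion at that point. -/
def IsClosedSubmanifold (k : ℕ) (M : Set N) : Prop :=
  IsClosed M ∧ ∀ p ∈ M, ∃ U : Set N, IsOpen U ∧ p ∈ U ∧ ∃ φ : N → (Fin k → ℝ),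
    ContMDiffOn I 𝓘(ℝ, Fin k → ℝ) ∞ φ U ∧ (∀ x ∈ U, x ∈ M ↔ φ x = 0) ∧
    Function.Surjective (mfderiv I 𝓘(ℝ, Fin k → ℝ) φ p)

/-- The tangent space of an embedded submanifold `M` at `p`: the tangent vectors annihilated by
the differentials of all smooth germs of functions at `p` that vanish on `M`. -/
def submanifoldTangentSpace (M : Set N) (p : N) : Submodule ℝ (TangentSpace I p) where
  carrier := {ξ | ∀ φ : N → ℝ, ContMDiffAt I 𝓘(ℝ, ℝ) ∞ φ p → (∀ᶠ y in 𝓝[M] p, φ y = 0) →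
    mfderiv I 𝓘(ℝ, ℝ) φ p ξ = 0}
  add_mem' := fun ha hb φ h h' => by
    rw [map_add, ha φ h h', hb φ h h', add_zero]
  zero_mem' := fun φ _ _ => map_zero _
  smul_mem' := fun c ξ hξ φ h h' => by
    rw [map_smul, hξ φ h h', smul_zero]

/-- `M` is invariant under the (local) flow of the vector field `X`: every integral curve of `X`
on an open interval around `0` that starts in `M` stays in `M`. -/
def IsFlowInvariant (X : ∀ x : N, TangentSpace I x) (M : Set N) : Prop :=
  ∀ (γ : ℝ → N) (a b : ℝ), (0 : ℝ) ∈ Ioo a b → IsMIntegralCurveOn γ X (Ioo a b) → γ 0 ∈ M →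
    ∀ t ∈ Ioo a b, γ t ∈ M

end Manifold

/-! ### Geometry of the tangent bundle -/

section TangentBundle

variable {E : Type*} [NormedAddCommGroup E] [NormedSpace ℝ E]
  {Q : Type*} [TopologicalSpace Q] [ChartedSpace E Q] [IsManifold 𝓘(ℝ, E) ∞ Q]

/-- The vertical lift `T_q Q → T_x (TQ)` at `x ∈ T_q Q`: the differential at `x` of the inclusion of
the fibre `T_q Q` in `TQ`. It maps `w` to the velocity at `0` of `t ↦ x + t w`. -/
def verticalLift (x : TangentBundle 𝓘(ℝ, E) Q) :
    TangentSpace 𝓘(ℝ, E) x.proj →L[ℝ] TangentSpace 𝓘(ℝ, E).tangent x :=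
  mfderiv 𝓘(ℝ, E) 𝓘(ℝ, E).tangent
    (fun w : E => (⟨x.proj, w⟩ : TangentBundle 𝓘(ℝ, E) Q)) x.snd

/-- The tangent map at `x` of the canonical projection `τ : TQ → Q`. -/
def tangentProj (x : TangentBundle 𝓘(ℝ, E) Q) :
    TangentSpace 𝓘(ℝ, E).tangent x →L[ℝ] TangentSpace 𝓘(ℝ, E) x.proj :=
  mfderiv 𝓘(ℝ, E).tangent 𝓘(ℝ, E) (fun y : TangentBundle 𝓘(ℝ, E) Q => y.proj) x

/-- The canonical almost tangent structure `J = dqⁱ ⊗ ∂/∂q̇ⁱ` on `TQ`. -/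
def almostTangent (x : TangentBundle 𝓘(ℝ, E) Q) :
    TangentSpace 𝓘(ℝ, E).tangent x →L[ℝ] TangentSpace 𝓘(ℝ, E).tangent x :=
  verticalLift x ∘L tangentProj x

/-- The vertical lift `αⱽ = τ^* α` of a one-form `α` on `Q`. -/
def oneFormVerticalLift (α : ∀ q : Q, TangentSpace 𝓘(ℝ, E) q →L[ℝ] ℝ)
    (x : TangentBundle 𝓘(ℝ, E) Q) : TangentSpace 𝓘(ℝ, E).tangent x →L[ℝ] ℝ :=
  α x.proj ∘L tangentProj x

/-- The vertical lift `Xⱽ = Xⁱ ∂/∂q̇ⁱ` of a vector field `X` on `Q`. -/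
def vectorVerticalLift (X : ∀ q : Q, TangentSpace 𝓘(ℝ, E) q)
    (x : TangentBundle 𝓘(ℝ, E) Q) : TangentSpace 𝓘(ℝ, E).tangent x :=
  verticalLift x (X x.proj)

/-- The differential of a function on `TQ`, as a one-form. -/
def functionDifferential (f : TangentBundle 𝓘(ℝ, E) Q → ℝ)
    (x : TangentBundle 𝓘(ℝ, E) Q) : TangentSpace 𝓘(ℝ, E).tangent x →L[ℝ] ℝ :=
  mfderiv 𝓘(ℝ, E).tangent 𝓘(ℝ, ℝ) f x

/-- The energy `E_L = q̇ ∂L/∂q̇ - L` of a Lagrangian `L`. -/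
def energy (L : TangentBundle 𝓘(ℝ, E) Q → ℝ) (x : TangentBundle 𝓘(ℝ, E) Q) : ℝ :=
  functionDifferential L x (verticalLift x x.snd) - L x

/-- The two-form `ω_L = -d(J^*(dL))` on `TQ`, as the map `♭ : ξ ↦ i_ξ ω_L`. -/
def lagrangianForm (L : TangentBundle 𝓘(ℝ, E) Q → ℝ) (x : TangentBundle 𝓘(ℝ, E) Q) :
    TangentSpace 𝓘(ℝ, E).tangent x →L[ℝ] TangentSpace 𝓘(ℝ, E).tangent x →L[ℝ] ℝ :=
  -oneFormExtDeriv 𝓘(ℝ, E).tangent (fun y => functionDifferential L y ∘L almostTangent y) x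

/-- The Euler-Lagrange vector field `♯_{ω_L}(dE_L)`, solution `G` of `i_G ω_L = dE_L`. -/
def eulerLagrangeField (L : TangentBundle 𝓘(ℝ, E) Q → ℝ) (x : TangentBundle 𝓘(ℝ, E) Q) :
    TangentSpace 𝓘(ℝ, E).tangent x :=
  sharp (lagrangianForm L x) (functionDifferential (energy L) x)

/-- The matrix `𝒢ᵢⱼ` of a Riemannian metric in the preferred chart of `Q` around `q`,
as a function on the chart. -/
def metricInChart (g : ContMDiffRiemannianMetric 𝓘(ℝ, E) ∞ E (TangentSpace 𝓘(ℝ, E) : Q → Type _))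
    (q : Q) : E → E →L[ℝ] E →L[ℝ] ℝ := fun y =>
  let T : E →L[ℝ] E := mfderiv 𝓘(ℝ, E) 𝓘(ℝ, E) (extChartAt 𝓘(ℝ, E) q).symm y
  bilinPullback (W := E) (W' := E) (g.inner ((extChartAt 𝓘(ℝ, E) q).symm y)) T T

/-- The complete lift `𝒢ᶜ` of a Riemannian metric to `TQ`, given in natural bundle coordinates
`(qⁱ, q̇ⁱ)` by `q̇ᵏ ∂ₖ𝒢ᵢⱼ dqⁱ ⊗ dqʲ + 𝒢ᵢⱼ dqⁱ ⊗ dq̇ʲ + 𝒢ᵢⱼ dq̇ⁱ ⊗ dqʲ`,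
as the map `♭ : ξ ↦ 𝒢ᶜ(ξ, ·)`. -/
def completeLift
    (g : ContMDiffRiemannianMetric 𝓘(ℝ, E) ∞ E (TangentSpace 𝓘(ℝ, E) : Q → Type _))
    (x : TangentBundle 𝓘(ℝ, E) Q) :
    TangentSpace 𝓘(ℝ, E).tangent x →L[ℝ] TangentSpace 𝓘(ℝ, E).tangent x →L[ℝ] ℝ :=
  let P : TangentSpace 𝓘(ℝ, E).tangent x →L[ℝ] E × E :=
    mfderiv 𝓘(ℝ, E).tangent 𝓘(ℝ, E × E) (extChartAt 𝓘(ℝ, E).tangent x) x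
  let dq : TangentSpace 𝓘(ℝ, E).tangent x →L[ℝ] E := ContinuousLinearMap.fst ℝ E E ∘L P
  let dv : TangentSpace 𝓘(ℝ, E).tangent x →L[ℝ] E := ContinuousLinearMap.snd ℝ E E ∘L P
  let c : E × E := extChartAt 𝓘(ℝ, E).tangent x x
  let g₀ : E →L[ℝ] E →L[ℝ] ℝ := metricInChart g x.proj c.1
  let dg : E →L[ℝ] E →L[ℝ] ℝ := bilinDirDeriv (metricInChart g x.proj) c.1 c.2
  bilinPullback dg dq dq + bilinPullback g₀ dq dv + bilinPullback g₀ dv dq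

end TangentBundle

/-! ### Mechanical control systems -/

/-- The data of a mechanical control system `∇_{q̇} q̇ = -grad V + u_a Y^a` on `Q`: a Riemannian
metric, a potential function `V` and one-forms `f¹, …, fᵐ`, all smooth; `Y^a = ♯_𝒢(f^a)`. -/
structure MechanicalControlSystem (E : Type*) [NormedAddCommGroup E] [NormedSpace ℝ E]
    (Q : Type*) [TopologicalSpace Q] [ChartedSpace E Q] [IsManifold 𝓘(ℝ, E) ∞ Q] (m : ℕ) where
  metric : ContMDiffRiemannianMetric 𝓘(ℝ, E) ∞ E (TangentSpace 𝓘(ℝ, E) : Q → Type _)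
  potential : Q → ℝ
  potential_smooth : ContMDiff 𝓘(ℝ, E) 𝓘(ℝ, ℝ) ∞ potential
  force : Fin m → ∀ q : Q, TangentSpace 𝓘(ℝ, E) q →L[ℝ] ℝ
  force_smooth : ∀ a, ContMDiff 𝓘(ℝ, E) (𝓘(ℝ, E).prod 𝓘(ℝ, E →L[ℝ] ℝ)) ∞
    (fun q => TotalSpace.mk' (E →L[ℝ] ℝ)
      (E := fun q : Q => TangentSpace 𝓘(ℝ, E) q →L[ℝ] Bundle.Trivial Q ℝ q) q (force a q))

namespace MechanicalControlSystem

variable {E : Type*} [NormedAddCommGroup E] [NormedSpace ℝ E]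
  {Q : Type*} [TopologicalSpace Q] [ChartedSpace E Q] [IsManifold 𝓘(ℝ, E) ∞ Q] {m : ℕ}
  (S : MechanicalControlSystem E Q m)

/-- The Lagrangian of mechanical type `L(v) = ½ 𝒢(v, v) - V(τ v)`. -/
def lagrangian (x : TangentBundle 𝓘(ℝ, E) Q) : ℝ :=
  1 / 2 * S.metric.inner x.proj x.snd x.snd - S.potential x.proj

/-- The control force vector fields `Y^a = ♯_𝒢(f^a)`. -/
def controlField (a : Fin m) (q : Q) : TangentSpace 𝓘(ℝ, E) q :=
  sharp (S.metric.inner q) (S.force a q)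

/-- The input distribution `ℱ = span {Y^a}` on `Q`. -/
def inputDistribution (q : Q) : Submodule ℝ (TangentSpace 𝓘(ℝ, E) q) :=
  Submodule.span ℝ (range fun a => S.controlField a q)

/-- The vertical lift `ℱⱽ` of the input distribution, a distribution on `TQ`. -/
def liftedInputDistribution (x : TangentBundle 𝓘(ℝ, E) Q) :
    Submodule ℝ (TangentSpace 𝓘(ℝ, E).tangent x) :=
  (S.inputDistribution x.proj).map (verticalLift x).toLinearMap

/-- The closed-loop vector field `Γ = G + u_a (Y^a)ⱽ` of a feedback `u : TQ → ℝᵐ`, where `G` is the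
Euler-Lagrange vector field of the mechanical Lagrangian. -/
def closedLoopField (u : TangentBundle 𝓘(ℝ, E) Q → Fin m → ℝ) (x : TangentBundle 𝓘(ℝ, E) Q) :
    TangentSpace 𝓘(ℝ, E).tangent x :=
  eulerLagrangeField S.lagrangian x + ∑ a, u x a • vectorVerticalLift (S.controlField a) x

/-- The one-form `i_Γ ω_L - dE_L` of a vector field `Γ` on `TQ`. -/
def chetaevForm (Γ : ∀ x : TangentBundle 𝓘(ℝ, E) Q, TangentSpace 𝓘(ℝ, E).tangent x)
    (x : TangentBundle 𝓘(ℝ, E) Q) : TangentSpace 𝓘(ℝ, E).tangent x →L[ℝ] ℝ :=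
  lagrangianForm S.lagrangian x (Γ x) - functionDifferential (energy S.lagrangian) x

/-- `τ : M → ℝᵐ` is a (smooth) control law making `M` a virtual nonholonomic constraint: it is the
restriction to `M` of a smooth feedback on `TQ` whose closed-loop flow leaves `M` invariant. -/
def IsControlLaw (M : Set (TangentBundle 𝓘(ℝ, E) Q)) (τ : M → Fin m → ℝ) : Prop :=
  ∃ u : TangentBundle 𝓘(ℝ, E) Q → Fin m → ℝ,
    ContMDiff 𝓘(ℝ, E).tangent 𝓘(ℝ, Fin m → ℝ) ∞ u ∧ (∀ x : M, u x = τ x) ∧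
    IsFlowInvariant 𝓘(ℝ, E).tangent (S.closedLoopField u) M

end MechanicalControlSystem

end

noncomputable section

/-! ### Zero sets of submersions -/

section ZeroSet

open Filter Asymptotics Metric

variable {F F₁ F₂ : Type*} [NormedAddCommGroup F] [NormedSpace ℝ F]
  [NormedAddCommGroup F₁] [NormedSpace ℝ F₁]
  [NormedAddCommGroup F₂] [NormedSpace ℝ F₂]

/-! For a mechanical Lagrangian, `J^*dL` is the Cartan form `θ = 𝒢(v, Tτ ·)`, equal to `𝒢ᵢⱼ q̇ⁱ dqʲ`
in natural coordinates. So `ω_L = -dθ` is nondegenerate, which gives `G`. On a vertical lift no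
derivative of the metric survives: both `dθ` and `𝒢ᶜ` send `wⱽ` to `𝒢(w, Tτ ·)`. Therefore
`i_{(Y^a)ⱽ} ω_L = -(f^a)ⱽ`, `♭_{𝒢ᶜ}((Y^a)ⱽ) = (f^a)ⱽ`, and `i_Γ ω_L - dE_L = -u_a (f^a)ⱽ` everywhere
for every feedback (`chetaevForm_closedLoopField`). The condition on this form in item 3 is thus
automatic, and the one in item 2 follows from `u = τ*` on `M`.

Two facts carry the rest. First, `M` is invariant exactly when `Γ` is tangent to it
(`isFlowInvariant_iff`). If `φ` is a local submersion defining `M`, tangency makes `dφ(Γ)` vanish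
where `φ` does, so `dφ(Γ) = O(φ)` and Grönwall keeps `φ` equal to zero along integral curves. The
`O(φ)` bound comes from metric regularity (`HasStrictFDerivAt.exists_zero_near`), and also
identifies the tangent space defined by germs with `ker dφ`.

Second, at each point of `M` exactly one `c` makes `G + c_a (Y^a)ⱽ` tangent
(`existsUnique_feedback`): the condition is `dφ(G) + A c = 0`, where `A` has columns `dφ((Y^a)ⱽ)`
and is invertible by transversality. The local solutions are smooth and a partition of unity glues
them (`exists_contMDiff_feedback`). This gives existence and uniqueness of the control law.

Smoothness of `G` and of `(Y^a)ⱽ` follows from solving `i_X dθ = β` in a fixed chart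
(`contMDiff_of_oneFormExtDeriv_eq`). -/

/-- Metric regularity: near a zero `p` of a submersion `f`, the distance of `y` to the zero set
is bounded by a multiple of `‖f y‖`. -/
theorem HasStrictFDerivAt.exists_zero_near [CompleteSpace F] [CompleteSpace F₁]
    {f : F → F₁} {f' : F →L[ℝ] F₁} {p : F}
    (hf : HasStrictFDerivAt f f' p) (hp : f p = 0) (hsurj : Function.Surjective f')
    {s : Set F} (hs : s ∈ 𝓝 p) :
    ∃ C : ℝ, ∀ᶠ y in 𝓝 p, ∃ z ∈ s, f z = 0 ∧ ‖y - z‖ ≤ C * ‖f y‖ := by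
  have hr : f'.range = ⊤ := LinearMap.range_eq_top.2 hsurj
  set R := f'.nonlinearRightInverseOfSurjective hr
  have hR : 0 < R.nnnorm := f'.nonlinearRightInverseOfSurjective_nnnorm_pos hr
  obtain ⟨t, ht, hft⟩ := hf.approximates_deriv_on_nhds (c := R.nnnorm⁻¹ / 2)
    (Or.inr (by positivity))
  obtain ⟨r, hr0, hrt⟩ := nhds_basis_closedBall.mem_iff.1 (inter_mem hs ht)
  -- The approximation constant is half of `‖R‖⁻¹`, so the image of the ball of radius `ρ` about `y`
  -- contains the ball of radius `ρ / (2‖R‖)` about `f y`. With `ρ = C ‖f y‖` this just reaches `0`.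
  set C : ℝ := 2 * R.nnnorm
  have hC : 0 < C := by positivity
  refine ⟨C, ?_⟩
  have hlim : Tendsto (fun y => ‖y - p‖ + C * ‖f y‖) (𝓝 p) (𝓝 0) := by
    have h1 : ContinuousAt (fun y => ‖y - p‖ + C * ‖f y‖) p := by
      have := hf.continuousAt
      fun_prop
    simpa [ContinuousAt, hp] using h1
  filter_upwards [hlim.eventually (gt_mem_nhds hr0)] with y hy
  have hsub : closedBall y (C * ‖f y‖) ⊆ closedBall p r :=
    closedBall_subset_closedBall' (by rw [dist_eq_norm]; linarith)
  have h0 : (0 : F₁) ∈ closedBall (f y)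
      (((R.nnnorm : ℝ)⁻¹ - (R.nnnorm⁻¹ / 2 : NNReal)) * (C * ‖f y‖)) := by
    have hR' : (R.nnnorm : ℝ) ≠ 0 := by positivity
    rw [mem_closedBall, dist_eq_norm, zero_sub, norm_neg]
    apply le_of_eq
    push_cast
    simp only [C]
    field_simp
    ring
  obtain ⟨z, hz, hz0⟩ := hft.surjOn_closedBall_of_nonlinearRightInverse R
    (by positivity) (hsub.trans (hrt.trans inter_subset_right)) h0
  refine ⟨z, (hrt (hsub hz)).1, hz0, ?_⟩
  rwa [mem_closedBall, dist_eq_norm, norm_sub_rev] at hz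

/-- A locally Lipschitz function vanishing on the zero set of a submersion `f` is `O(f)`. -/
theorem HasStrictFDerivAt.isBigO_of_zero [CompleteSpace F] [CompleteSpace F₁]
    {f : F → F₁} {f' : F →L[ℝ] F₁} {p : F}
    (hf : HasStrictFDerivAt f f' p) (hp : f p = 0) (hsurj : Function.Surjective f')
    {h : F → F₂} (hh : ContDiffAt ℝ 1 h p) (h0 : ∀ᶠ y in 𝓝 p, f y = 0 → h y = 0) :
    h =O[𝓝 p] f := by
  obtain ⟨K, t, ht, hK⟩ := hh.exists_lipschitzOnWith
  obtain ⟨C, hC⟩ := hf.exists_zero_near hp hsurj (inter_mem ht h0)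
  refine IsBigO.of_bound (K * C) ?_
  filter_upwards [hC, ht] with y ⟨z, ⟨hzt, hz⟩, hz0, hyz⟩ hyt
  have := hK.norm_sub_le hyt hzt
  rw [hz hz0, sub_zero] at this
  calc ‖h y‖ ≤ K * ‖y - z‖ := this
    _ ≤ K * (C * ‖f y‖) := by gcongr
    _ = _ := by ring

/-- A differentiable function which is `O(f)` has a differential vanishing on `ker df`. -/
theorem HasFDerivAt.apply_eq_zero_of_isBigO {f : F → F₁} {f' : F →L[ℝ] F₁} {p : F}
    (hf : HasFDerivAt f f' p) (hp : f p = 0) {h : F → F₂} {h' : F →L[ℝ] F₂}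
    (hh : HasFDerivAt h h' p) (hO : h =O[𝓝 p] f) {v : F} (hv : f' v = 0) : h' v = 0 := by
  have hhp : h p = 0 := by
    obtain ⟨C, hC⟩ := hO.bound
    simpa [hp] using hC.self_of_nhds
  -- Along the line `p + t v` the map `f` is `o(t)`, hence so is `h = O(f)`.
  have hl : HasDerivAt (fun t : ℝ => p + t • v) v 0 := by
    simpa using ((hasDerivAt_id (0 : ℝ)).smul_const v).const_add p
  have hl0 : p + (0 : ℝ) • v = p := by simp
  have h1 : HasDerivAt (fun t : ℝ => f (p + t • v)) 0 0 := by
    rw [← hv]; exact HasFDerivAt.comp_hasDerivAt (0 : ℝ) (by rwa [hl0]) hl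
  have h2 : HasDerivAt (fun t : ℝ => h (p + t • v)) (h' v) 0 :=
    HasFDerivAt.comp_hasDerivAt (0 : ℝ) (by rwa [hl0]) hl
  have hlim : Tendsto (fun t : ℝ => p + t • v) (𝓝 0) (𝓝 p) := by
    simpa [ContinuousAt] using hl.continuousAt
  have h3 : HasDerivAt (fun t : ℝ => h (p + t • v)) 0 0 := by
    rw [hasDerivAt_iff_isLittleO] at h1 ⊢
    simp only [hl0, hp, hhp, sub_zero, smul_zero] at h1 ⊢
    exact (hO.comp_tendsto hlim).trans_isLittleO h1
  exact h2.unique h3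

/-- A curve satisfying `‖ψ'‖ ≤ C ‖ψ‖` which vanishes at a point vanishes nearby. -/
theorem eventually_eq_zero_of_norm_deriv_le {ψ ψ' : ℝ → F₁} {t₀ C : ℝ}
    (hψ : ∀ᶠ t in 𝓝 t₀, HasDerivAt ψ (ψ' t) t) (hb : ∀ᶠ t in 𝓝 t₀, ‖ψ' t‖ ≤ C * ‖ψ t‖)
    (h0 : ψ t₀ = 0) : ∀ᶠ t in 𝓝 t₀, ψ t = 0 := by
  obtain ⟨r, hr, hball⟩ := Metric.eventually_nhds_iff_ball.1 (hψ.and hb)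
  rw [Real.ball_eq_Ioo] at hball
  -- Grönwall's inequality runs forward in time only; the past of `t₀` is reached by reflecting
  -- time.
  have forward : ∀ χ χ' : ℝ → F₁, (∀ t ∈ Ico 0 r, HasDerivAt χ (χ' t) t ∧ ‖χ' t‖ ≤ C * ‖χ t‖) →
      χ 0 = 0 → ∀ t ∈ Ico 0 r, χ t = 0 := by
    intro χ χ' h hχ t ht
    have hsub : ∀ x ∈ Icc 0 t, x ∈ Ico 0 r := fun x hx => ⟨hx.1, hx.2.trans_lt ht.2⟩
    have := norm_le_gronwallBound_of_norm_deriv_right_le (f := χ) (f' := χ') (δ := 0) (K := C)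
      (ε := 0) (a := 0) (b := t) (fun x hx => (h x (hsub x hx)).1.continuousAt.continuousWithinAt)
      (fun x hx => (h x (hsub x (Ico_subset_Icc_self hx))).1.hasDerivWithinAt) (by simp [hχ])
      (fun x hx => by simpa using (h x (hsub x (Ico_subset_Icc_self hx))).2) t ⟨ht.1, le_rfl⟩
    simpa [gronwallBound_ε0] using this
  have hplus : ∀ t ∈ Ico 0 r, ψ (t₀ + t) = 0 :=
    forward (fun t => ψ (t₀ + t)) (fun t => ψ' (t₀ + t)) (fun t ht => by
      have := hball (t₀ + t) ⟨by linarith [ht.1], by linarith [ht.2]⟩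
      exact ⟨this.1.comp_const_add t₀ t, this.2⟩) (by simpa using h0)
  have hminus : ∀ t ∈ Ico 0 r, ψ (t₀ - t) = 0 :=
    forward (fun t => ψ (t₀ - t)) (fun t => -ψ' (t₀ - t)) (fun t ht => by
      have := hball (t₀ - t) ⟨by linarith [ht.2], by linarith [ht.1]⟩
      exact ⟨this.1.comp_const_sub t₀ t, by simpa using this.2⟩) (by simpa using h0)
  filter_upwards [Metric.ball_mem_nhds t₀ hr] with t ht
  rw [Real.ball_eq_Ioo] at ht
  rcases le_total t₀ t with h | h
  · simpa using hplus (t - t₀) ⟨by linarith, by linarith [ht.2]⟩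
  · simpa using hminus (t₀ - t) ⟨by linarith, by linarith [ht.1]⟩

end ZeroSet

/-! ### Invariance of submanifolds under flows -/

section Invariance

open Filter Asymptotics

set_option linter.unusedSectionVars false

variable {F : Type*} [NormedAddCommGroup F] [NormedSpace ℝ F]
  {H : Type*} [TopologicalSpace H]
  {I : ModelWithCorners ℝ F H} [I.Boundaryless] {N : Type*} [TopologicalSpace N]
  [ChartedSpace H N] [IsManifold I ∞ N]
  {F₁ F₂ : Type*} [NormedAddCommGroup F₁] [NormedSpace ℝ F₁]
  [NormedAddCommGroup F₂] [NormedSpace ℝ F₂]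

variable (I) in
/-- The differential at `p` of a map to a normed space, as a map on the model space of the
manifold. -/
def modelDifferential (φ : N → F₂) (p : N) : F →L[ℝ] F₂ :=
  mfderiv I 𝓘(ℝ, F₂) φ p

theorem MDifferentiableAt.hasFDerivAt_comp_extChartAt_symm {φ : N → F₂} {p : N}
    (h : MDifferentiableAt I 𝓘(ℝ, F₂) φ p) :
    HasFDerivAt (φ ∘ (extChartAt I p).symm) (modelDifferential I φ p) (extChartAt I p p) := by
  have h' : HasFDerivWithinAt (φ ∘ (extChartAt I p).symm)
    (modelDifferential I φ p) (range I) (extChartAt I p p) := h.hasMFDerivAt.2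
  rwa [I.range_eq_univ, hasFDerivWithinAt_univ] at h'

theorem ContMDiffAt.contDiffAt_comp_extChartAt_symm {φ : N → F₂} {p : N} {n : ℕ∞ω}
    (h : ContMDiffAt I 𝓘(ℝ, F₂) n φ p) :
    ContDiffAt ℝ n (φ ∘ (extChartAt I p).symm) (extChartAt I p p) := by
  have := (contMDiffAt_iff.1 h).2
  simpa [I.range_eq_univ, contDiffWithinAt_univ] using! this

/-- A `C^1` function vanishing on the zero set of a submersion `φ` is `O(φ)`. -/
theorem ContMDiffAt.isBigO_of_zero [CompleteSpace F] [CompleteSpace F₁] {φ : N → F₁} {p : N}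
    (hφ : ContMDiffAt I 𝓘(ℝ, F₁) 1 φ p) (hp : φ p = 0)
    (hsurj : Function.Surjective (mfderiv I 𝓘(ℝ, F₁) φ p))
    {h : N → F₂} (hh : ContMDiffAt I 𝓘(ℝ, F₂) 1 h p) (h0 : ∀ᶠ y in 𝓝 p, φ y = 0 → h y = 0) :
    h =O[𝓝 p] φ := by
  have hd := (hφ.mdifferentiableAt one_ne_zero).hasFDerivAt_comp_extChartAt_symm
  have hs := hφ.contDiffAt_comp_extChartAt_symm.hasStrictFDerivAt' hd one_ne_zero
  have hsymm : Tendsto (extChartAt I p).symm (𝓝 (extChartAt I p p)) (𝓝 p) := by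
    simpa [ContinuousAt] using continuousAt_extChartAt_symm (I := I) p
  have hO := hs.isBigO_of_zero (by simpa using hp) hsurj hh.contDiffAt_comp_extChartAt_symm
    (hsymm.eventually h0)
  have hO' := hO.comp_tendsto (continuousAt_extChartAt (I := I) p)
  refine (hO'.congr' ?_ ?_) <;>
  · filter_upwards [extChartAt_source_mem_nhds (I := I) p] with y hy
    simp only [Function.comp_apply, (extChartAt I p).left_inv hy]

/-- The coordinates of `φ` are themselves germs vanishing on `M`. No submersion hypothesis enters,
so this applies at all points of `M` near a given one, where surjectivity of `dφ` has not been
assumed. -/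
theorem mfderiv_apply_eq_zero_of_mem_submanifoldTangentSpace {k : ℕ} {M : Set N}
    {φ : N → Fin k → ℝ} {p : N} (hφ : ContMDiffAt I 𝓘(ℝ, Fin k → ℝ) ∞ φ p)
    (hM : ∀ᶠ x in 𝓝[M] p, φ x = 0) {ξ : TangentSpace I p}
    (hξ : ξ ∈ submanifoldTangentSpace I M p) :
    (mfderiv I 𝓘(ℝ, Fin k → ℝ) φ p ξ : Fin k → ℝ) = 0 := by
  funext i
  have hi : ContMDiffAt I 𝓘(ℝ, ℝ) ∞ (fun y => φ y i) p := contMDiffAt_pi_space.1 hφ i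
  have h0 := hξ (fun y => φ y i) hi (hM.mono fun y hy => by rw [hy]; rfl)
  have e1 := (hi.mdifferentiableAt (by simp)).hasFDerivAt_comp_extChartAt_symm
  have e2 := (hasFDerivAt_pi'.1
    (hφ.mdifferentiableAt (by simp)).hasFDerivAt_comp_extChartAt_symm) i
  exact (congrArg (fun L : F →L[ℝ] ℝ => L ξ) (e1.unique e2)).symm.trans h0

/-- The tangent space at `p` of the zero set of a submersion `φ` is the kernel of `dφ`. -/
theorem mem_submanifoldTangentSpace_iff [CompleteSpace F] {k : ℕ} {M U : Set N} (hU : IsOpen U)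
    {φ : N → Fin k → ℝ} (hφ : ContMDiffOn I 𝓘(ℝ, Fin k → ℝ) ∞ φ U)
    (hM : ∀ x ∈ U, x ∈ M ↔ φ x = 0) {p : N} (hpU : p ∈ U) (hpM : p ∈ M)
    (hsurj : Function.Surjective (mfderiv I 𝓘(ℝ, Fin k → ℝ) φ p)) (ξ : TangentSpace I p) :
    ξ ∈ submanifoldTangentSpace I M p ↔ (mfderiv I 𝓘(ℝ, Fin k → ℝ) φ p ξ : Fin k → ℝ) = 0 := by
  have hφp : ContMDiffAt I 𝓘(ℝ, Fin k → ℝ) ∞ φ p := hφ.contMDiffAt (hU.mem_nhds hpU)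
  have hdφ := hφp.mdifferentiableAt (by simp)
  have hp0 : φ p = 0 := (hM p hpU).1 hpM
  constructor
  · refine mfderiv_apply_eq_zero_of_mem_submanifoldTangentSpace hφp ?_
    filter_upwards [self_mem_nhdsWithin, mem_nhdsWithin_of_mem_nhds (hU.mem_nhds hpU)] with y h1 h2
    exact (hM y h2).1 h1
  · intro hξ f hf hfM
    -- A germ vanishing on `M` is `O(φ)`, so its differential vanishes on `ker dφ`.
    have hO : f =O[𝓝 p] φ := by
      refine ContMDiffAt.isBigO_of_zero (hφp.of_le (by simp)) hp0 hsurj (hf.of_le (by simp)) ?_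
      rw [eventually_nhdsWithin_iff] at hfM
      filter_upwards [hfM, hU.mem_nhds hpU] with y hy hyU h0
      exact hy ((hM y hyU).2 h0)
    have hsymm : Tendsto (extChartAt I p).symm (𝓝 (extChartAt I p p)) (𝓝 p) := by
      simpa [ContinuousAt] using continuousAt_extChartAt_symm (I := I) p
    exact hdφ.hasFDerivAt_comp_extChartAt_symm.apply_eq_zero_of_isBigO (by simpa using hp0)
      (hf.mdifferentiableAt (by simp)).hasFDerivAt_comp_extChartAt_symm
      (hO.comp_tendsto hsymm) hξ

/-- The function is the fibre component of the tangent map of `φ` composed with the section `X`. -/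
theorem ContMDiffOn.contMDiffAt_mfderiv_apply {U : Set N} (hU : IsOpen U) {φ : N → F₂}
    (hφ : ContMDiffOn I 𝓘(ℝ, F₂) ∞ φ U) {X : ∀ x : N, TangentSpace I x} {p : N} (hp : p ∈ U)
    (hX : ContMDiffAt I I.tangent ∞ (fun x => (⟨x, X x⟩ : TangentBundle I N)) p) :
    ContMDiffAt I 𝓘(ℝ, F₂) ∞ (fun y => (mfderiv I 𝓘(ℝ, F₂) φ y (X y) : F₂)) p := by
  have : IsManifold I 1 N := IsManifold.of_le (n := ∞) (by simp)
  have h1 := hφ.contMDiffOn_tangentMapWithin (m := ∞) (by simp) hU.uniqueMDiffOn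
  have h2 : ContMDiffAt I 𝓘(ℝ, F₂).tangent ∞ (tangentMapWithin I 𝓘(ℝ, F₂) φ U ∘
      fun x => (⟨x, X x⟩ : TangentBundle I N)) p :=
    ContMDiffAt.comp p (h1.contMDiffAt
      ((hU.preimage (FiberBundle.continuous_proj F (TangentSpace I))).mem_nhds hp)) hX
  have h3 := (contMDiff_snd_tangentBundle_modelSpace F₂ 𝓘(ℝ, F₂) (n := ∞)).contMDiffAt.comp p h2
  refine h3.congr_of_eventuallyEq ?_
  filter_upwards [hU.mem_nhds hp] with y hy
  change (mfderiv I 𝓘(ℝ, F₂) φ y (X y) : F₂) = mfderivWithin I 𝓘(ℝ, F₂) φ U y (X y)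
  rw [mfderivWithin_of_isOpen hU hy]

theorem HasMFDerivAt.hasDerivAt_comp {φ : N → F₂} {γ : ℝ → N} {t : ℝ} {ξ : TangentSpace I (γ t)}
    (hγ : HasMFDerivAt 𝓘(ℝ, ℝ) I γ t ((1 : ℝ →L[ℝ] ℝ).smulRight ξ))
    (hφ : MDifferentiableAt I 𝓘(ℝ, F₂) φ (γ t)) :
    HasDerivAt (φ ∘ γ) (modelDifferential I φ (γ t) ξ) t := by
  have h : HasFDerivAt (φ ∘ γ) ((modelDifferential I φ (γ t)).comp
    ((1 : ℝ →L[ℝ] ℝ).smulRight (id ξ : F))) t := (hφ.hasMFDerivAt.comp t hγ).hasFDerivAt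
  simpa using! h.hasDerivAt

/-- A closed submanifold is invariant under the flow of a smooth vector field if and only if the
vector field is tangent to it. -/
theorem isFlowInvariant_iff [CompleteSpace F] {k : ℕ} {M : Set N} (hM : IsClosedSubmanifold I k M)
    {X : ∀ x : N, TangentSpace I x}
    (hX : ContMDiff I I.tangent ∞ (fun x => (⟨x, X x⟩ : TangentBundle I N))) :
    IsFlowInvariant I X M ↔ ∀ x ∈ M, X x ∈ submanifoldTangentSpace I M x := by
  have : IsManifold I 1 N := IsManifold.of_le (n := ∞) (by simp)
  constructor
  · intro h x hx f hf hfM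
    -- The integral curve through `x` stays in `M`, so `f ∘ γ` vanishes near `0` and its derivative
    -- `df(X x)` is zero.
    obtain ⟨γ, hγ0, hγ⟩ := exists_isMIntegralCurveAt_of_contMDiffAt_boundaryless (I := I) (v := X)
      (x₀ := x) 0 ((hX x).of_le (by simp))
    subst hγ0
    obtain ⟨r, hr, hball⟩ := Metric.eventually_nhds_iff_ball.1 hγ
    rw [Real.ball_eq_Ioo, zero_sub, zero_add] at hball
    have h0 : (0 : ℝ) ∈ Ioo (-r) r := ⟨by linarith, hr⟩
    have hin := h γ (-r) r h0 (fun t ht => (hball t ht).hasMFDerivWithinAt) hx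
    have hd := (hball 0 h0).hasDerivAt_comp (hf.mdifferentiableAt (by simp))
    have hγc : Tendsto γ (𝓝 0) (𝓝[M] (γ 0)) := by
      refine tendsto_nhdsWithin_of_tendsto_nhds_of_eventually_within _
        (hball 0 h0).continuousAt ?_
      filter_upwards [Ioo_mem_nhds h0.1 h0.2] with t ht using hin t ht
    have hz : HasDerivAt (f ∘ γ) 0 0 :=
      (hasDerivAt_const (0 : ℝ) (0 : ℝ)).congr_of_eventuallyEq (hγc.eventually hfM)
    exact hd.unique hz
  · intro h γ a b h0 hγ hγ0
    have hγ' : ∀ t ∈ Ioo a b,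
        HasMFDerivAt 𝓘(ℝ, ℝ) I γ t ((1 : ℝ →L[ℝ] ℝ).smulRight (X (γ t))) :=
      fun t ht => (hγ t ht).hasMFDerivAt (Ioo_mem_nhds ht.1 ht.2)
    have hcont : ContinuousOn γ (Ioo a b) :=
      fun t ht => (hγ' t ht).continuousAt.continuousWithinAt
    have hopen : ∀ t ∈ Ioo a b, γ t ∈ M → ∀ᶠ s in 𝓝 t, γ s ∈ M := by
      intro t ht htM
      obtain ⟨U, hU, hpU, φ, hφ, hφM, hsurj⟩ := hM.2 (γ t) htM
      have hφp := hφ.contMDiffAt (hU.mem_nhds hpU)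
      have hp0 := (hφM _ hpU).1 htM
      have hc := (hγ' t ht).continuousAt
      -- By tangency `dφ(X)` vanishes on the zero set of `φ`; the resulting bound turns `ψ = φ ∘ γ`
      -- into a solution of `‖ψ'‖ ≤ C ‖ψ‖`.
      have hO : (fun y => (mfderiv I 𝓘(ℝ, Fin k → ℝ) φ y (X y) : Fin k → ℝ)) =O[𝓝 (γ t)] φ := by
        refine (hφp.of_le (by simp)).isBigO_of_zero hp0 hsurj
          ((hφ.contMDiffAt_mfderiv_apply hU hpU (hX _)).of_le (by simp)) ?_
        filter_upwards [hU.mem_nhds hpU] with y hy hy0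
        refine mfderiv_apply_eq_zero_of_mem_submanifoldTangentSpace
          (hφ.contMDiffAt (hU.mem_nhds hy)) ?_ (h y ((hφM y hy).2 hy0))
        filter_upwards [self_mem_nhdsWithin, mem_nhdsWithin_of_mem_nhds (hU.mem_nhds hy)]
          with z h1 h2 using (hφM z h2).1 h1
      obtain ⟨C, hC⟩ := hO.bound
      have hUt := hc.eventually (hU.mem_nhds hpU)
      have hz := eventually_eq_zero_of_norm_deriv_le (ψ := φ ∘ γ) (t₀ := t)
        (ψ' := fun s => (mfderiv I 𝓘(ℝ, Fin k → ℝ) φ (γ s) (X (γ s)) : Fin k → ℝ)) (C := C)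
        (by
          filter_upwards [Ioo_mem_nhds ht.1 ht.2, hUt] with s hs hsU
          exact (hγ' s hs).hasDerivAt_comp
            ((hφ.contMDiffAt (hU.mem_nhds hsU)).mdifferentiableAt (by simp)))
        (hc.eventually hC) hp0
      filter_upwards [hz, hUt] with s hs hsU using (hφM _ hsU).2 hs
    have : PreconnectedSpace (Ioo a b) := Subtype.preconnectedSpace isPreconnected_Ioo
    -- Closed because `M` is closed, open by the Grönwall step; the interval is connected.
    have hclopen : IsClopen {t : Ioo a b | γ t ∈ M} := by
      refine ⟨hM.1.preimage hcont.domRestrict, isOpen_iff_mem_nhds.2 fun t ht => ?_⟩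
      exact continuous_subtype_val.continuousAt.eventually (hopen t t.2 ht)
    have huniv := hclopen.eq_univ ⟨⟨0, h0⟩, hγ0⟩
    intro t ht
    exact (huniv ▸ mem_univ (⟨t, ht⟩ : Ioo a b) : _ ∈ {t : Ioo a b | γ t ∈ M})

end Invariance

/-! ### Feedbacks making a transversal submanifold invariant -/

section Feedback

open Filter

set_option linter.unusedSectionVars false

variable {F : Type*} [NormedAddCommGroup F] [NormedSpace ℝ F] [FiniteDimensional ℝ F]
  {H : Type*} [TopologicalSpace H]
  {I : ModelWithCorners ℝ F H} [I.Boundaryless] {N : Type*} [TopologicalSpace N]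
  [ChartedSpace H N] [IsManifold I ∞ N]

/-- A surjection `L` onto `ℝᵐ` restricts to an isomorphism on the span of `m` vectors which is
complementary to its kernel. -/
theorem bijective_sum_smul_of_ker_sup_span_eq_top {V : Type*} [AddCommGroup V] [Module ℝ V] {m : ℕ}
    (L : V →ₗ[ℝ] (Fin m → ℝ)) (hL : Function.Surjective L) (Y : Fin m → V)
    (h : LinearMap.ker L ⊔ Submodule.span ℝ (range Y) = ⊤) :
    Function.Bijective (Fintype.linearCombination ℝ (fun a => L (Y a))) := by
  have hs : Function.Surjective (Fintype.linearCombination ℝ (fun a => L (Y a))) := by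
    intro w
    obtain ⟨v, rfl⟩ := hL w
    obtain ⟨k, hk, y, hy, rfl⟩ := Submodule.mem_sup.1 (h ▸ Submodule.mem_top (x := v))
    obtain ⟨c, rfl⟩ := (Submodule.mem_span_range_iff_exists_fun ℝ).1 hy
    exact ⟨c, by simp [Fintype.linearCombination_apply, LinearMap.mem_ker.1 hk]⟩
  exact ⟨LinearMap.injective_iff_surjective.2 hs, hs⟩

/-- The map `c ↦ ∑ c_a dφ(Y_a)`. -/
def controlMatrix {m : ℕ} (φ : N → Fin m → ℝ) (Y : Fin m → ∀ x : N, TangentSpace I x) (x : N) :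
    (Fin m → ℝ) →L[ℝ] (Fin m → ℝ) :=
  ∑ a, (ContinuousLinearMap.proj (R := ℝ) (φ := fun _ : Fin m => ℝ) a).smulRight
    (modelDifferential I φ x (Y a x))

theorem modelDifferential_add_sum_smul {m : ℕ} (φ : N → Fin m → ℝ)
    (Y : Fin m → ∀ x : N, TangentSpace I x) (x : N) (ξ : TangentSpace I x) (c : Fin m → ℝ) :
    modelDifferential I φ x (ξ + ∑ a, c a • Y a x : TangentSpace I x) =
      modelDifferential I φ x ξ + controlMatrix φ Y x c := by
  let L : TangentSpace I x →L[ℝ] (Fin m → ℝ) := modelDifferential I φ x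
  change L (ξ + ∑ a, c a • Y a x) = L ξ + controlMatrix φ Y x c
  simp only [map_add, map_sum, map_smul, controlMatrix, sum_apply]
  rfl

variable {m : ℕ} {M : Set N} {G : ∀ x : N, TangentSpace I x}
  {Y : Fin m → ∀ x : N, TangentSpace I x}

/-- Since `ker dφ` is the tangent space of `M`, transversality makes the `m` vectors `dφ(Y_a)` span
`ℝᵐ`, hence form a basis. -/
theorem controlMatrix_isInvertible {U : Set N} (hU : IsOpen U) {φ : N → Fin m → ℝ}
    (hφ : ContMDiffOn I 𝓘(ℝ, Fin m → ℝ) ∞ φ U) (hM : ∀ x ∈ U, x ∈ M ↔ φ x = 0) {p : N}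
    (hpU : p ∈ U) (hpM : p ∈ M) (hsurj : Function.Surjective (mfderiv I 𝓘(ℝ, Fin m → ℝ) φ p))
    (htrans : submanifoldTangentSpace I M p ⊔ Submodule.span ℝ (range fun a => Y a p) = ⊤) :
    (controlMatrix φ Y p).IsInvertible := by
  set L : TangentSpace I p →ₗ[ℝ] (Fin m → ℝ) := (modelDifferential I φ p).toLinearMap
  have hker : LinearMap.ker L = submanifoldTangentSpace I M p := by
    ext ξ
    exact (mem_submanifoldTangentSpace_iff hU hφ hM hpU hpM hsurj ξ).symm
  have hb := bijective_sum_smul_of_ker_sup_span_eq_top L hsurj (fun a => Y a p) (by rwa [hker])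
  have he : ∀ c, Fintype.linearCombination ℝ (fun a => L (Y a p)) c = controlMatrix φ Y p c := by
    intro c
    simp only [Fintype.linearCombination_apply, controlMatrix, sum_apply]
    rfl
  have hb' : Function.Bijective (controlMatrix φ Y p) := by
    convert hb using 1
    ext1 c; exact (he c).symm
  exact ⟨(LinearEquiv.ofBijective (controlMatrix φ Y p).toLinearMap hb').toContinuousLinearEquiv,
    by ext1 c; rfl⟩

/-- Tangency is the square linear system `dφ(G) + A c = 0` with invertible matrix `A`. -/
theorem existsUnique_feedback (hM : IsClosedSubmanifold I m M) {p : N} (hp : p ∈ M)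
    (htrans : submanifoldTangentSpace I M p ⊔ Submodule.span ℝ (range fun a => Y a p) = ⊤) :
    ∃! c : Fin m → ℝ, G p + ∑ a, c a • Y a p ∈ submanifoldTangentSpace I M p := by
  obtain ⟨U, hU, hpU, φ, hφ, hφM, hsurj⟩ := hM.2 p hp
  obtain ⟨e, he⟩ := controlMatrix_isInvertible hU hφ hφM hpU hp hsurj htrans
  have key : ∀ c : Fin m → ℝ, G p + ∑ a, c a • Y a p ∈ submanifoldTangentSpace I M p ↔
      c = e.symm (-modelDifferential I φ p (G p)) := by
    intro c
    rw [mem_submanifoldTangentSpace_iff hU hφ hφM hpU hp hsurj]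
    change modelDifferential I φ p (G p + ∑ a, c a • Y a p : TangentSpace I p) = 0 ↔ _
    rw [modelDifferential_add_sum_smul, ← he, e.eq_symm_apply, add_comm, add_eq_zero_iff_eq_neg]
    rfl
  exact ⟨_, (key _).2 rfl, fun c hc => (key c).1 hc⟩

theorem contMDiffOn_controlMatrix {U : Set N} (hU : IsOpen U) {φ : N → Fin m → ℝ}
    (hφ : ContMDiffOn I 𝓘(ℝ, Fin m → ℝ) ∞ φ U)
    (hY : ∀ a, ContMDiff I I.tangent ∞ (fun x => (⟨x, Y a x⟩ : TangentBundle I N))) :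
    ContMDiffOn I 𝓘(ℝ, (Fin m → ℝ) →L[ℝ] (Fin m → ℝ)) ∞ (controlMatrix φ Y) U := by
  refine contMDiffOn_finsetSum fun a _ y hy => ?_
  have h := hφ.contMDiffAt_mfderiv_apply hU hy (hY a y)
  exact ((ContinuousLinearMap.smulRightL ℝ (Fin m → ℝ) (Fin m → ℝ)
    (ContinuousLinearMap.proj a)).contDiff.contDiffAt.comp_contMDiffAt h).contMDiffWithinAt

/-- Near a point of `M` the formula `-A⁻¹ dφ(G)` makes sense and is smooth off `M` too. Being
tangent along `M` is a convex condition on the value of the feedback, so a partition of unity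
produces a global one. -/
theorem exists_contMDiff_feedback [SigmaCompactSpace N] [T2Space N]
    (hM : IsClosedSubmanifold I m M)
    (hG : ContMDiff I I.tangent ∞ (fun x => (⟨x, G x⟩ : TangentBundle I N)))
    (hY : ∀ a, ContMDiff I I.tangent ∞ (fun x => (⟨x, Y a x⟩ : TangentBundle I N)))
    (htrans : ∀ x ∈ M,
      submanifoldTangentSpace I M x ⊔ Submodule.span ℝ (range fun a => Y a x) = ⊤) :
    ∃ u : N → Fin m → ℝ, ContMDiff I 𝓘(ℝ, Fin m → ℝ) ∞ u ∧
      ∀ x ∈ M, G x + ∑ a, u x a • Y a x ∈ submanifoldTangentSpace I M x := by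
  let t : N → Set (Fin m → ℝ) := fun x =>
    {c | x ∈ M → G x + ∑ a, c a • Y a x ∈ submanifoldTangentSpace I M x}
  -- On `M` the admissible set has at most one element by uniqueness; off `M` it is all of `ℝᵐ`.
  have ht : ∀ x, Convex ℝ (t x) := by
    intro x c hc d hd α β hα hβ hαβ hx
    obtain ⟨e, -, he⟩ := existsUnique_feedback (G := G) hM hx (htrans x hx)
    have h1 := he c (hc hx)
    have h2 := he d (hd hx)
    subst h1 h2
    rw [← add_smul, hαβ, one_smul]
    exact hc hx
  obtain ⟨u, hu⟩ := exists_contMDiffMap_forall_mem_convex_of_local I (n := ⊤) ht (by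
    intro p
    by_cases hp : p ∈ M
    · obtain ⟨U, hU, hpU, φ, hφ, hφM, hsurj⟩ := hM.2 p hp
      have hinv := controlMatrix_isInvertible hU hφ hφM hpU hp hsurj (htrans p hp)
      have hA : ContMDiffOn I 𝓘(ℝ, (Fin m → ℝ) →L[ℝ] (Fin m → ℝ)) ∞ (controlMatrix φ Y) U :=
        contMDiffOn_controlMatrix hU hφ hY
      have hopen : ∀ᶠ y in 𝓝 p, (controlMatrix φ Y y).IsInvertible := by
        obtain ⟨e, he⟩ := hinv
        have := (hA.contMDiffAt (hU.mem_nhds hpU)).continuousAt.eventually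
          (he ▸ ContinuousLinearEquiv.nhds e)
        exact this
      obtain ⟨W, hWU, hW, hpW⟩ := _root_.mem_nhds_iff.1 (inter_mem (hU.mem_nhds hpU) hopen)
      refine ⟨W, hW.mem_nhds hpW,
        fun y => (controlMatrix φ Y y).inverse (-modelDifferential I φ y (G y)), ?_, ?_⟩
      · intro y hy
        obtain ⟨e, he⟩ := (hWU hy).2
        have h1 : ContMDiffAt I 𝓘(ℝ, (Fin m → ℝ) →L[ℝ] (Fin m → ℝ)) ∞
            (fun y => (controlMatrix φ Y y).inverse) y :=
          ContDiffAt.comp_contMDiffAt (g := ContinuousLinearMap.inverse)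
            (he ▸ contDiffAt_map_inverse e) (hA.contMDiffAt (hU.mem_nhds (hWU hy).1))
        have h2 : ContMDiffAt I 𝓘(ℝ, Fin m → ℝ) ∞ (fun y => -modelDifferential I φ y (G y)) y :=
          (hφ.contMDiffAt_mfderiv_apply hU (hWU hy).1 (hG y)).neg
        exact (h1.clm_apply h2).contMDiffWithinAt
      · intro y hy hyM
        obtain ⟨e, he⟩ := (hWU hy).2
        -- The definition of submanifold gives surjectivity of `dφ` only at `p`; at nearby `y` it is
        -- recovered from invertibility of the control matrix.
        have hs : Function.Surjective (mfderiv I 𝓘(ℝ, Fin m → ℝ) φ y) := by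
          intro w
          refine ⟨0 + ∑ a, e.symm w a • Y a y, ?_⟩
          have := modelDifferential_add_sum_smul φ Y y 0 (e.symm w)
          rw [← he] at this
          exact this.trans ((congrArg (· + _) (map_zero (modelDifferential I φ y))).trans
            ((zero_add _).trans (e.apply_symm_apply w)))
        rw [mem_submanifoldTangentSpace_iff hU hφ hφM (hWU hy).1 hyM hs]
        refine (modelDifferential_add_sum_smul φ Y y (G y) _).trans ?_
        refine (congrArg (_ + ·) ((hWU hy).2.self_apply_inverse
          (-modelDifferential I φ y (G y)))).trans ?_
        exact add_neg_cancel (modelDifferential I φ y (G y))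
    · refine ⟨Mᶜ, hM.1.isOpen_compl.mem_nhds hp, fun _ => 0, contMDiffOn_const, ?_⟩
      intro y hy hyM
      exact absurd hyM hy)
  exact ⟨u, u.contMDiff, fun x hx => hu x hx⟩

end Feedback

/-! ### The exterior derivative of one-forms in charts -/

section ExteriorDerivative

open Filter

set_option linter.unusedSectionVars false

variable {F : Type*} [NormedAddCommGroup F] [NormedSpace ℝ F]
  {H : Type*} [TopologicalSpace H]
  {I : ModelWithCorners ℝ F H} [I.Boundaryless] {N : Type*} [TopologicalSpace N]
  [ChartedSpace H N] [IsManifold I ∞ N]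

/-- An injective map into the dual is invertible by dimension. For the metric, `ω_L` and `𝒢ᶜ` this
makes `sharp` a genuine inverse instead of the default value `0`. -/
theorem isInvertible_of_separatingLeft [FiniteDimensional ℝ F] (B : F →L[ℝ] F →L[ℝ] ℝ)
    (hB : ∀ v, (∀ w, B v w = 0) → v = 0) : B.IsInvertible := by
  have hinj : Function.Injective B.toLinearMap := by
    rw [← LinearMap.ker_eq_bot, LinearMap.ker_eq_bot']
    intro v hv
    exact hB v fun w => DFunLike.congr_fun hv w
  have hfin : Module.finrank ℝ F = Module.finrank ℝ (F →L[ℝ] ℝ) := by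
    rw [← (LinearMap.toContinuousLinearMap (𝕜 := ℝ) (E := F) (F' := ℝ)).finrank_eq]
    exact Subspace.dual_finrank_eq.symm
  exact ⟨(LinearEquiv.ofInjectiveOfFinrankEq B.toLinearMap hinj hfin).toContinuousLinearEquiv, rfl⟩

theorem ContDiffAt.clm_inverse_apply {F₁ F₂ : Type*} [NormedAddCommGroup F₁] [NormedSpace ℝ F₁]
    [CompleteSpace F₁] [NormedAddCommGroup F₂] [NormedSpace ℝ F₂] {n : ℕ∞ω}
    {A : F → F₁ →L[ℝ] F₂} {b : F → F₂} {z : F} (hA : ContDiffAt ℝ n A z) (hb : ContDiffAt ℝ n b z)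
    (hinv : (A z).IsInvertible) : ContDiffAt ℝ n (fun y => (A y).inverse (b y)) z := by
  obtain ⟨e, he⟩ := hinv
  have h1 : ContDiffAt ℝ n (fun y => (A y).inverse) z :=
    ContDiffAt.comp z (g := ContinuousLinearMap.inverse) (he ▸ contDiffAt_map_inverse e) hA
  exact h1.clm_apply hb

theorem ContDiffOn.clm_flip {F₁ F₂ F₃ : Type*} [NormedAddCommGroup F₁] [NormedSpace ℝ F₁]
    [NormedAddCommGroup F₂] [NormedSpace ℝ F₂] [NormedAddCommGroup F₃] [NormedSpace ℝ F₃]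
    [FiniteDimensional ℝ F₁] [FiniteDimensional ℝ F₂]
    {n : ℕ∞ω} {A : F → F₁ →L[ℝ] F₂ →L[ℝ] F₃} {s : Set F} (hA : ContDiffOn ℝ n A s) :
    ContDiffOn ℝ n (fun y => (A y).flip) s :=
  contDiffOn_clm_apply.2 fun _ => contDiffOn_clm_apply.2 fun _ =>
    (hA.clm_apply contDiffOn_const).clm_apply contDiffOn_const

/-- The exterior derivative commutes with pullbacks, in a normed space. -/
theorem fderiv_pullback_antisymm {β : F → F →L[ℝ] ℝ} {κ : F → F} {y : F}
    (hβ : DifferentiableAt ℝ β (κ y)) (hκ : ContDiffAt ℝ 2 κ y) (v w : F) :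
    fderiv ℝ (fun z => β (κ z) ∘L fderiv ℝ κ z) y v w -
      fderiv ℝ (fun z => β (κ z) ∘L fderiv ℝ κ z) y w v =
    fderiv ℝ β (κ y) (fderiv ℝ κ y v) (fderiv ℝ κ y w) -
      fderiv ℝ β (κ y) (fderiv ℝ κ y w) (fderiv ℝ κ y v) := by
  have h1 : HasFDerivAt (fun z => β (κ z)) (fderiv ℝ β (κ y) ∘L fderiv ℝ κ y) y :=
    hβ.hasFDerivAt.comp y (hκ.differentiableAt (by simp)).hasFDerivAt
  have h2 : HasFDerivAt (fderiv ℝ κ) (fderiv ℝ (fderiv ℝ κ) y) y :=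
    ((hκ.fderiv_right (m := 1) (by norm_num)).differentiableAt (by simp)).hasFDerivAt
  -- The terms containing the second derivative of `κ` cancel in the antisymmetrization.
  have hsymm := hκ.isSymmSndFDerivAt (by simp) v w
  rw [(h1.clm_comp h2).fderiv]
  simp [hsymm]

theorem mdifferentiableAt_extChartAt_symm {x : N} {y : F} (hy : y ∈ (extChartAt I x).target) :
    MDifferentiableAt 𝓘(ℝ, F) I (extChartAt I x).symm y := by
  have : IsManifold I 1 N := IsManifold.of_le (n := ∞) (by simp)
  have := mdifferentiableWithinAt_extChartAt_symm hy
  rwa [I.range_eq_univ, mdifferentiableWithinAt_univ] at this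

/-- The local representatives of a one-form transform by pullback under changes of charts. -/
theorem oneFormInChart_eventuallyEq (α : ∀ y : N, TangentSpace I y →L[ℝ] ℝ) {x x₀ : N}
    (hx : x ∈ (extChartAt I x₀).source) :
    oneFormInChart I α x =ᶠ[𝓝 (extChartAt I x x)] fun y =>
      oneFormInChart I α x₀ ((extChartAt I x₀ ∘ (extChartAt I x).symm) y) ∘L
        fderiv ℝ (extChartAt I x₀ ∘ (extChartAt I x).symm) y := by
  have : IsManifold I 1 N := IsManifold.of_le (n := ∞) (by simp)
  have hs : ∀ᶠ y in 𝓝 (extChartAt I x x), (extChartAt I x).symm y ∈ (extChartAt I x₀).source := by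
    refine (continuousAt_extChartAt_symm x).eventually ?_
    rw [extChartAt_to_inv]
    exact (isOpen_extChartAt_source x₀).mem_nhds hx
  filter_upwards [hs.eventually_nhds, extChartAt_target_mem_nhds x] with y hy hyt
  set κ : F → F := extChartAt I x₀ ∘ (extChartAt I x).symm
  have hyx := hy.self_of_nhds
  have heq : (extChartAt I x).symm =ᶠ[𝓝 y] (extChartAt I x₀).symm ∘ κ := by
    filter_upwards [hy] with z hz
    exact ((extChartAt I x₀).left_inv hz).symm
  have hκ : MDifferentiableAt 𝓘(ℝ, F) 𝓘(ℝ, F) κ y :=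
    (mdifferentiableAt_extChartAt (by simpa using! hyx)).comp y
      (mdifferentiableAt_extChartAt_symm hyt)
  have hd : mfderiv 𝓘(ℝ, F) I (extChartAt I x).symm y =
      (mfderiv 𝓘(ℝ, F) I (extChartAt I x₀).symm (κ y)).comp (mfderiv 𝓘(ℝ, F) 𝓘(ℝ, F) κ y) := by
    rw [heq.mfderiv_eq]
    exact mfderiv_comp y
      (mdifferentiableAt_extChartAt_symm ((extChartAt I x₀).map_source hyx)) hκ
  have hp : (extChartAt I x₀).symm (κ y) = (extChartAt I x).symm y := (extChartAt I x₀).left_inv hyx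
  -- Viewing all tangent spaces as the model space lets equal base points be rewritten without
  -- transporting fibres.
  let α' : N → F →L[ℝ] ℝ := fun z => α z
  let D : F →L[ℝ] F := mfderiv 𝓘(ℝ, F) I (extChartAt I x).symm y
  let D₀ : F →L[ℝ] F := mfderiv 𝓘(ℝ, F) I (extChartAt I x₀).symm (κ y)
  have hd' : D = D₀ ∘L fderiv ℝ κ y := by
    rw [← mfderiv_eq_fderiv]; exact hd
  change α' ((extChartAt I x).symm y) ∘L D = (α' ((extChartAt I x₀).symm (κ y)) ∘L D₀) ∘L fderiv ℝ κ y
  rw [hd', hp]; rfl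

/-- The exterior derivative of a one-form may be computed in any chart. -/
theorem oneFormExtDeriv_apply_eq {α : ∀ y : N, TangentSpace I y →L[ℝ] ℝ} {x x₀ : N}
    (hx : x ∈ (extChartAt I x₀).source)
    (hα : DifferentiableAt ℝ (oneFormInChart I α x₀) (extChartAt I x₀ x)) (ξ η : TangentSpace I x) :
    oneFormExtDeriv I α x ξ η =
      fderiv ℝ (oneFormInChart I α x₀) (extChartAt I x₀ x)
        (modelDifferential I (extChartAt I x₀) x ξ) (modelDifferential I (extChartAt I x₀) x η) -
      fderiv ℝ (oneFormInChart I α x₀) (extChartAt I x₀ x)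
        (modelDifferential I (extChartAt I x₀) x η) (modelDifferential I (extChartAt I x₀) x ξ) := by
  have : IsManifold I 1 N := IsManifold.of_le (n := ∞) (by simp)
  set κ : F → F := extChartAt I x₀ ∘ (extChartAt I x).symm with hκ_def
  have hκx : κ (extChartAt I x x) = extChartAt I x₀ x := by simp [κ]
  have hκ : ContDiffAt ℝ 2 κ (extChartAt I x x) := by
    have := contMDiffAt_extChartAt' (I := I) (n := 2) (x := x₀) (by simpa using! hx)
    exact this.contDiffAt_comp_extChartAt_symm
  have hP : fderiv ℝ κ (extChartAt I x x) = modelDifferential I (extChartAt I x₀) x :=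
    (mdifferentiableAt_extChartAt
      (by simpa using! hx)).hasFDerivAt_comp_extChartAt_symm.fderiv
  have key := fderiv_pullback_antisymm (β := oneFormInChart I α x₀) (κ := κ) (hκx ▸ hα) hκ
  have heq := (oneFormInChart_eventuallyEq (I := I) α hx).fderiv_eq (𝕜 := ℝ)
  rw [← hκ_def] at heq
  rw [← heq, hκx, hP] at key
  -- `oneFormExtDeriv` at `x` uses the chart preferred at `x`, whose differential there is the
  -- identity.
  let P : F →L[ℝ] F := mfderiv I 𝓘(ℝ, F) (extChartAt I x) x
  have hself : P = ContinuousLinearMap.id ℝ F := mfderiv_extChartAt_self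
  let D : F →L[ℝ] F →L[ℝ] ℝ := fderiv ℝ (oneFormInChart I α x) (extChartAt I x x)
  change D (P ξ) (P η) - D (P η) (P ξ) = _
  rw [hself]
  exact key ξ η

theorem modelDifferential_extChartAt_bijective {x x₀ : N} (hx : x ∈ (extChartAt I x₀).source) :
    Function.Bijective (modelDifferential I (extChartAt I x₀) x) := by
  have : IsManifold I 1 N := IsManifold.of_le (n := ∞) (by simp)
  exact (isInvertible_mfderiv_extChartAt hx).bijective

theorem oneForm_apply_eq (β : ∀ y : N, TangentSpace I y →L[ℝ] ℝ) {x x₀ : N}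
    (hx : x ∈ (extChartAt I x₀).source) (η : TangentSpace I x) :
    β x η = oneFormInChart I β x₀ (extChartAt I x₀ x)
      (modelDifferential I (extChartAt I x₀) x η) := by
  have : IsManifold I 1 N := IsManifold.of_le (n := ∞) (by simp)
  have h := mfderivWithin_extChartAt_symm_comp_mfderiv_extChartAt' hx
  rw [I.range_eq_univ, mfderivWithin_univ] at h
  let β' : N → F →L[ℝ] ℝ := fun z => β z
  let D : F →L[ℝ] F := mfderiv 𝓘(ℝ, F) I (extChartAt I x₀).symm (extChartAt I x₀ x)
  have hD : D (modelDifferential I (extChartAt I x₀) x η) = η := DFunLike.congr_fun h η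
  change β' x η = β' ((extChartAt I x₀).symm (extChartAt I x₀ x))
    (D (modelDifferential I (extChartAt I x₀) x η))
  rw [hD, (extChartAt I x₀).left_inv hx]

/-- A vector field is smooth if its local representatives in charts are. -/
theorem contMDiffAt_section_of_modelDifferential {X : ∀ x : N, TangentSpace I x} {x₀ : N}
    (h : ContMDiffAt I 𝓘(ℝ, F) ∞ (fun x => modelDifferential I (extChartAt I x₀) x (X x)) x₀) :
    ContMDiffAt I I.tangent ∞ (fun x => (⟨x, X x⟩ : TangentBundle I N)) x₀ := by
  have : IsManifold I 1 N := IsManifold.of_le (n := ∞) (by simp)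
  refine ((trivializationAt F (TangentSpace I) x₀).contMDiffAt_section_iff
    (FiberBundle.mem_baseSet_trivializationAt' x₀)).2 (h.congr_of_eventuallyEq ?_)
  filter_upwards [(chartAt H x₀).open_source.mem_nhds (mem_chart_source H x₀)] with x hx
  have h1 := TangentBundle.continuousLinearMapAt_trivializationAt (I := I) hx
  refine Eq.trans ?_ (DFunLike.congr_fun h1 (X x))
  rw [Trivialization.continuousLinearMapAt_apply]
  exact (Trivialization.coe_linearMapAt_of_mem (R := ℝ) _ ((TangentBundle.trivializationAt_baseSet (I := I) x₀).symm ▸ hx)).symm ▸ rfl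

/-- If `ω = -dθ` is nondegenerate, the solution `X` of `i_X ω = β` is smooth. -/
theorem contMDiff_of_oneFormExtDeriv_eq [FiniteDimensional ℝ F]
    {θ β : ∀ y : N, TangentSpace I y →L[ℝ] ℝ}
    (hθ : ∀ x₀, ContDiffOn ℝ ∞ (oneFormInChart I θ x₀) (extChartAt I x₀).target)
    (hβ : ∀ x₀, ContDiffOn ℝ ∞ (oneFormInChart I β x₀) (extChartAt I x₀).target)
    (hnd : ∀ x (ξ : TangentSpace I x), (∀ η, oneFormExtDeriv I θ x ξ η = 0) → ξ = 0)
    {X : ∀ x : N, TangentSpace I x} (hX : ∀ x, oneFormExtDeriv I θ x (X x) = β x) :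
    ContMDiff I I.tangent ∞ (fun x => (⟨x, X x⟩ : TangentBundle I N)) := by
  intro x₀
  refine contMDiffAt_section_of_modelDifferential ?_
  -- `oneFormExtDeriv` changes chart with the point. Reading it in the single chart at `x₀` makes
  -- the solution `Ω⁻¹ β`, smooth because inversion of linear maps is.
  let Ω : F → F →L[ℝ] F →L[ℝ] ℝ := fun z =>
    fderiv ℝ (oneFormInChart I θ x₀) z - (fderiv ℝ (oneFormInChart I θ x₀) z).flip
  have hopen : IsOpen (extChartAt I x₀).target := isOpen_extChartAt_target x₀
  have hΩ : ∀ x (hx : x ∈ (extChartAt I x₀).source) (ξ η : TangentSpace I x),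
      oneFormExtDeriv I θ x ξ η = Ω (extChartAt I x₀ x)
        (modelDifferential I (extChartAt I x₀) x ξ)
        (modelDifferential I (extChartAt I x₀) x η) := by
    intro x hx ξ η
    have hz := (extChartAt I x₀).map_source hx
    rw [oneFormExtDeriv_apply_eq hx (((hθ x₀).contDiffAt (hopen.mem_nhds hz)).differentiableAt
      (by simp))]
    rfl
  have hinv : ∀ x ∈ (extChartAt I x₀).source, (Ω (extChartAt I x₀ x)).IsInvertible := by
    intro x hx
    have hb := modelDifferential_extChartAt_bijective (I := I) hx
    refine isInvertible_of_separatingLeft _ fun v hv => ?_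
    obtain ⟨ξ, rfl⟩ := hb.2 v
    have h0 : (show TangentSpace I x from ξ) = 0 := hnd x ξ fun η => (hΩ x hx ξ η).trans (hv _)
    exact (congrArg _ h0).trans (map_zero _)
  have hΩs : ContDiffOn ℝ ∞ Ω (extChartAt I x₀).target := by
    have h1 := (hθ x₀).fderiv_of_isOpen hopen (m := ∞) (by simp)
    exact h1.sub (h1.clm_flip)
  have hloc : ContDiffOn ℝ ∞ (fun z => (Ω z).inverse (oneFormInChart I β x₀ z))
      (extChartAt I x₀).target := by
    intro z hz
    have hi := hinv _ ((extChartAt I x₀).map_target hz)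
    rw [(extChartAt I x₀).right_inv hz] at hi
    exact ((hΩs.contDiffAt (hopen.mem_nhds hz)).clm_inverse_apply
      ((hβ x₀).contDiffAt (hopen.mem_nhds hz)) hi).contDiffWithinAt
  have hx₀ := mem_extChartAt_source (I := I) x₀
  have h2 := ((hloc.contDiffAt (hopen.mem_nhds
    ((extChartAt I x₀).map_source hx₀))).comp_contMDiffAt (contMDiffAt_extChartAt (x := x₀)))
  refine h2.congr_of_eventuallyEq ?_
  filter_upwards [extChartAt_source_mem_nhds (I := I) x₀] with x hx
  rw [eq_comm]
  refine (hinv x hx).inverse_apply_eq.2 ?_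
  ext v
  obtain ⟨η, rfl⟩ := (modelDifferential_extChartAt_bijective (I := I) hx).2 v
  exact (oneForm_apply_eq (I := I) (x := x) β hx η).symm.trans
    ((DFunLike.congr_fun (hX x) η).symm.trans (hΩ x hx (X x) η))

end ExteriorDerivative

/-! ### Canonical maps on the tangent bundle in charts -/

section TangentBundleCharts

open Filter

set_option linter.unusedSectionVars false

variable {E : Type*} [NormedAddCommGroup E] [NormedSpace ℝ E]
  {Q : Type*} [TopologicalSpace Q] [ChartedSpace E Q] [IsManifold 𝓘(ℝ, E) ∞ Q]

theorem TangentBundle.contMDiff_fibre_inclusion (q : Q) :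
    ContMDiff 𝓘(ℝ, E) 𝓘(ℝ, E).tangent ∞
      (fun w : E => (⟨q, w⟩ : TangentBundle 𝓘(ℝ, E) Q)) := by
  intro w
  refine contMDiffAt_totalSpace.2 ⟨contMDiffAt_const, ?_⟩
  have h : (fun w : E => (trivializationAt E (TangentSpace 𝓘(ℝ, E)) q
      (⟨q, w⟩ : TangentBundle 𝓘(ℝ, E) Q)).2) =
      (tangentBundleCore 𝓘(ℝ, E) Q).coordChange (achart E q) (achart E q) q := rfl
  exact h ▸ ContinuousLinearMap.contMDiffAt _

theorem TangentBundle.contMDiff_proj :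
    ContMDiff 𝓘(ℝ, E).tangent 𝓘(ℝ, E) ∞ (fun y : TangentBundle 𝓘(ℝ, E) Q => y.proj) :=
  Bundle.contMDiff_proj (TangentSpace 𝓘(ℝ, E))

theorem TangentBundle.extChartAt_fibre (x : TangentBundle 𝓘(ℝ, E) Q) (w : E) :
    extChartAt 𝓘(ℝ, E).tangent x (⟨x.proj, w⟩ : TangentBundle 𝓘(ℝ, E) Q) =
      (extChartAt 𝓘(ℝ, E) x.proj x.proj, w) := by
  refine Prod.ext rfl ?_
  exact (tangentBundleCore 𝓘(ℝ, E) Q).coordChange_self (achart E x.proj) x.proj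
    (mem_chart_source E x.proj) w

theorem TangentBundle.extChartAt_self (x : TangentBundle 𝓘(ℝ, E) Q) :
    extChartAt 𝓘(ℝ, E).tangent x x = (extChartAt 𝓘(ℝ, E) x.proj x.proj, (x.snd : E)) :=
  TangentBundle.extChartAt_fibre x x.snd

theorem TangentBundle.mem_extChartAt_target {x : TangentBundle 𝓘(ℝ, E) Q} {z : E × E} :
    z ∈ (extChartAt 𝓘(ℝ, E).tangent x).target ↔ z.1 ∈ (extChartAt 𝓘(ℝ, E) x.proj).target := by
  rw [extChartAt_target, extChartAt_target, ModelWithCorners.range_eq_univ,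
    ModelWithCorners.range_eq_univ, inter_univ, inter_univ]
  exact TangentBundle.mem_chart_target_iff (I := 𝓘(ℝ, E)) z x

/-- The derivative of the inverse of a chart of `Q`. -/
def chartSymmDeriv (q : Q) (y : E) : E →L[ℝ] E :=
  mfderiv 𝓘(ℝ, E) 𝓘(ℝ, E) (extChartAt 𝓘(ℝ, E) q).symm y

/-- Natural charts of `TQ` are tangent maps of charts of `Q`, and so are their inverses. -/
theorem TangentBundle.extChartAt_symm_apply {x : TangentBundle 𝓘(ℝ, E) Q} {z : E × E}
    (hz : z.1 ∈ (extChartAt 𝓘(ℝ, E) x.proj).target) :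
    (extChartAt 𝓘(ℝ, E).tangent x).symm z =
      (⟨(extChartAt 𝓘(ℝ, E) x.proj).symm z.1, chartSymmDeriv x.proj z.1 z.2⟩ :
        TangentBundle 𝓘(ℝ, E) Q) := by
  have : IsManifold 𝓘(ℝ, E) 1 Q := IsManifold.of_le (n := ∞) (by simp)
  exact (tangentMap_chart_symm (I := 𝓘(ℝ, E)) (p := x)
    (q := (⟨z.1, z.2⟩ : TangentBundle 𝓘(ℝ, E) E)) (by simpa using hz)).symm

theorem chartSymmDeriv_self (q : Q) :
    chartSymmDeriv q (extChartAt 𝓘(ℝ, E) q q) = ContinuousLinearMap.id ℝ E := by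
  have : IsManifold 𝓘(ℝ, E) 1 Q := IsManifold.of_le (n := ∞) (by simp)
  have := mfderivWithin_range_extChartAt_symm (I := 𝓘(ℝ, E)) (x := q)
  rw [modelWithCornersSelf_coe, range_id, mfderivWithin_univ] at this
  exact this

/-- The tangent space at `x` is the model space `E × E` read through the chart preferred at `x`; in
that chart `τ` is the first projection. -/
theorem tangentProj_apply (x : TangentBundle 𝓘(ℝ, E) Q)
    (ξ : TangentSpace 𝓘(ℝ, E).tangent x) : tangentProj x ξ = (ξ : E × E).1 := by
  have : IsManifold 𝓘(ℝ, E) 1 Q := IsManifold.of_le (n := ∞) (by simp)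
  have h : HasFDerivAt (fun z : E × E => z.1)
      (ContinuousLinearMap.fst ℝ E E) (extChartAt 𝓘(ℝ, E).tangent x x) := hasFDerivAt_fst
  have hp := (TangentBundle.contMDiff_proj (E := E) (Q := Q) x).mdifferentiableAt (by simp)
  have hc : MDifferentiableAt 𝓘(ℝ, E) 𝓘(ℝ, E) (extChartAt 𝓘(ℝ, E) x.proj) x.proj :=
    mdifferentiableAt_extChartAt (mem_chart_source E x.proj)
  have h1 := mfderiv_comp x hc hp
  have h2 : MDifferentiableAt 𝓘(ℝ, E).tangent 𝓘(ℝ, E × E) (extChartAt 𝓘(ℝ, E).tangent x) x :=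
    mdifferentiableAt_extChartAt (mem_chart_source (ModelProd E E) x)
  have h3 := mfderiv_comp x (I' := 𝓘(ℝ, E × E)) (I'' := 𝓘(ℝ, E)) (g := Prod.fst)
    h.differentiableAt.mdifferentiableAt h2
  have heq : (extChartAt 𝓘(ℝ, E) x.proj) ∘ (fun y : TangentBundle 𝓘(ℝ, E) Q => y.proj) =
    Prod.fst ∘ (extChartAt 𝓘(ℝ, E).tangent x) := rfl
  rw [heq, h3, mfderiv_extChartAt_self, mfderiv_extChartAt_self, mfderiv_eq_fderiv] at h1
  have h4 := DFunLike.congr_fun h1 ξ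
  have h5 : fderiv ℝ Prod.fst (extChartAt 𝓘(ℝ, E).tangent x x) (ξ : E × E) = (ξ : E × E).1 := by
    rw [h.fderiv]; rfl
  exact h4.symm.trans h5

theorem verticalLift_apply (x : TangentBundle 𝓘(ℝ, E) Q)
    (w : TangentSpace 𝓘(ℝ, E) x.proj) : (verticalLift x w : E × E) = (0, (w : E)) := by
  let v : E := x.snd
  have hi := (TangentBundle.contMDiff_fibre_inclusion x.proj v).mdifferentiableAt (by simp)
  have h2 : MDifferentiableAt 𝓘(ℝ, E).tangent 𝓘(ℝ, E × E) (extChartAt 𝓘(ℝ, E).tangent x)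
      (⟨x.proj, v⟩ : TangentBundle 𝓘(ℝ, E) Q) :=
    mdifferentiableAt_extChartAt (mem_chart_source (ModelProd E E) x)
  have h1 := mfderiv_comp (I' := 𝓘(ℝ, E).tangent) v h2 hi
  have heq : (extChartAt 𝓘(ℝ, E).tangent x) ∘
      (fun w : E => (⟨x.proj, w⟩ : TangentBundle 𝓘(ℝ, E) Q)) =
      fun w => (extChartAt 𝓘(ℝ, E) x.proj x.proj, w) := by
    funext w; exact TangentBundle.extChartAt_fibre x w
  have hd : HasFDerivAt (fun w : E => (extChartAt 𝓘(ℝ, E) x.proj x.proj, w))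
      (ContinuousLinearMap.inr ℝ E E) v :=
    (hasFDerivAt_const _ _).prodMk (hasFDerivAt_id _)
  rw [heq, mfderiv_eq_fderiv, hd.fderiv] at h1
  have h3 := DFunLike.congr_fun h1 w
  have h4 : ∀ ξ : TangentSpace 𝓘(ℝ, E).tangent x,
      (mfderiv 𝓘(ℝ, E).tangent 𝓘(ℝ, E × E) (extChartAt 𝓘(ℝ, E).tangent x) x ξ : E × E) = ξ := by
    intro ξ; rw [mfderiv_extChartAt_self]; rfl
  exact ((h4 _).symm.trans h3.symm)

end TangentBundleCharts

/-! ### The Cartan one-form of a Riemannian metric -/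

section CartanForm

open Filter

set_option linter.unusedSectionVars false
set_option synthInstance.maxHeartbeats 100000

variable {E : Type*} [NormedAddCommGroup E] [NormedSpace ℝ E]
  {Q : Type*} [TopologicalSpace Q] [ChartedSpace E Q] [IsManifold 𝓘(ℝ, E) ∞ Q]
  {F : Type*} [NormedAddCommGroup F] [NormedSpace ℝ F] {H : Type*} [TopologicalSpace H]
  {I : ModelWithCorners ℝ F H} {N : Type*} [TopologicalSpace N] [ChartedSpace H N]
  (g : ContMDiffRiemannianMetric 𝓘(ℝ, E) ∞ E (TangentSpace 𝓘(ℝ, E) : Q → Type _))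

/-- The scalar product of two smooth vector fields along a map is smooth. -/
theorem contMDiffOn_metric_inner {b : N → Q} {v w : ∀ y, TangentSpace 𝓘(ℝ, E) (b y)} {s : Set N}
    (hv : ContMDiffOn I 𝓘(ℝ, E).tangent ∞ (fun y => (⟨b y, v y⟩ : TangentBundle 𝓘(ℝ, E) Q)) s)
    (hw : ContMDiffOn I 𝓘(ℝ, E).tangent ∞ (fun y => (⟨b y, w y⟩ : TangentBundle 𝓘(ℝ, E) Q)) s) :
    ContMDiffOn I 𝓘(ℝ, ℝ) ∞ (fun y => g.inner (b y) (v y) (w y)) s := by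
  intro x hx
  have hb : ContMDiffWithinAt I 𝓘(ℝ, E) ∞ b s x :=
    (TangentBundle.contMDiff_proj _).comp_contMDiffWithinAt x (hv x hx)
  have : ContMDiffWithinAt I (𝓘(ℝ, E).prod 𝓘(ℝ, ℝ)) ∞
      (fun y => TotalSpace.mk' ℝ (E := Bundle.Trivial Q ℝ) (b y)
        (g.inner (b y) (v y) (w y))) s x := by
    apply ContMDiffWithinAt.clm_bundle_apply₂ (F₁ := E) (F₂ := E)
    · exact ContMDiffAt.comp_contMDiffWithinAt x g.contMDiff.contMDiffAt hb
    · exact hv x hx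
    · exact hw x hx
  exact (contMDiffWithinAt_totalSpace.1 this).2

/-- This is the coordinate vector field in direction `w`: the inverse of a natural chart of `TQ`
with the fibre coordinate frozen at `w`. -/
theorem TangentBundle.contMDiffOn_extChartAt_symm_mk (q : Q) (w : E) :
    ContMDiffOn 𝓘(ℝ, E) 𝓘(ℝ, E).tangent ∞
      (fun y : E => (⟨(extChartAt 𝓘(ℝ, E) q).symm y, chartSymmDeriv q y w⟩ :
        TangentBundle 𝓘(ℝ, E) Q)) (extChartAt 𝓘(ℝ, E) q).target := by
  let x : TangentBundle 𝓘(ℝ, E) Q := ⟨q, (0 : E)⟩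
  have h1 : ContMDiffOn 𝓘(ℝ, E) 𝓘(ℝ, E × E) ∞ (fun y : E => (y, w))
      (extChartAt 𝓘(ℝ, E) q).target :=
    contMDiffOn_iff_contDiffOn.2 (contDiff_id.prodMk contDiff_const).contDiffOn
  have h2 := (contMDiffOn_extChartAt_symm (n := ∞) (I := 𝓘(ℝ, E).tangent) x).comp h1
    fun y hy => TangentBundle.mem_extChartAt_target.2 hy
  refine h2.congr fun y hy => ?_
  exact (TangentBundle.extChartAt_symm_apply (x := x) (z := (y, w)) hy).symm

theorem metricInChart_apply (q : Q) (y w w' : E) :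
    metricInChart g q y w w' = g.inner ((extChartAt 𝓘(ℝ, E) q).symm y)
      (chartSymmDeriv q y w) (chartSymmDeriv q y w') := rfl

theorem contDiffOn_metricInChart [FiniteDimensional ℝ E] (q : Q) :
    ContDiffOn ℝ ∞ (metricInChart g q) (extChartAt 𝓘(ℝ, E) q).target := by
  refine contDiffOn_clm_apply.2 fun w => contDiffOn_clm_apply.2 fun w' => ?_
  exact contMDiffOn_iff_contDiffOn.1 (contMDiffOn_metric_inner g
    (TangentBundle.contMDiffOn_extChartAt_symm_mk q w)
    (TangentBundle.contMDiffOn_extChartAt_symm_mk q w'))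

/-- The metric at `q` as a bilinear form on the model space. -/
def metricAt (q : Q) : E →L[ℝ] E →L[ℝ] ℝ :=
  g.inner q

theorem metricInChart_self (q : Q) :
    metricInChart g q (extChartAt 𝓘(ℝ, E) q q) = metricAt g q := by
  refine ContinuousLinearMap.ext fun w => ContinuousLinearMap.ext fun w' => ?_
  rw [metricInChart_apply, chartSymmDeriv_self]
  let B : Q → E →L[ℝ] E →L[ℝ] ℝ := fun p => g.inner p
  change B ((extChartAt 𝓘(ℝ, E) q).symm (extChartAt 𝓘(ℝ, E) q q)) w w' = B q w w'
  rw [extChartAt_to_inv]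

/-- The Cartan one-form `ξ ↦ 𝒢(v, Tτ ξ)` of a Riemannian metric. -/
def cartanForm (x : TangentBundle 𝓘(ℝ, E) Q) : TangentSpace 𝓘(ℝ, E).tangent x →L[ℝ] ℝ :=
  g.inner x.proj x.snd ∘L tangentProj x

theorem tangentProj_comp_mfderiv_symm {x : TangentBundle 𝓘(ℝ, E) Q} {z : E × E}
    (hz : z.1 ∈ (extChartAt 𝓘(ℝ, E) x.proj).target) (ζ : E × E) :
    (tangentProj ((extChartAt 𝓘(ℝ, E).tangent x).symm z)
      (mfderiv 𝓘(ℝ, E × E) 𝓘(ℝ, E).tangent (extChartAt 𝓘(ℝ, E).tangent x).symm z ζ) : E) =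
      chartSymmDeriv x.proj z.1 ζ.1 := by
  have h1 := mfderiv_comp z (I'' := 𝓘(ℝ, E))
    ((TangentBundle.contMDiff_proj (E := E) (Q := Q) _).mdifferentiableAt (by simp))
    (mdifferentiableAt_extChartAt_symm (I := 𝓘(ℝ, E).tangent) (x := x)
      (TangentBundle.mem_extChartAt_target.2 hz))
  have h2 := mfderiv_comp z (I := 𝓘(ℝ, E × E)) (I'' := 𝓘(ℝ, E)) (f := Prod.fst)
    (mdifferentiableAt_extChartAt_symm (I := 𝓘(ℝ, E)) (x := x.proj) hz)
    (hasFDerivAt_fst (𝕜 := ℝ)).differentiableAt.mdifferentiableAt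
  have heq : (fun y : TangentBundle 𝓘(ℝ, E) Q => y.proj) ∘ (extChartAt 𝓘(ℝ, E).tangent x).symm =
    (extChartAt 𝓘(ℝ, E) x.proj).symm ∘ Prod.fst := rfl
  rw [heq, h2, mfderiv_eq_fderiv, fderiv_fst] at h1
  exact (DFunLike.congr_fun h1 ζ).symm

theorem oneFormInChart_cartanForm {x : TangentBundle 𝓘(ℝ, E) Q} {z : E × E}
    (hz : z ∈ (extChartAt 𝓘(ℝ, E).tangent x).target) :
    oneFormInChart 𝓘(ℝ, E).tangent (cartanForm g) x z =
      (metricInChart g x.proj z.1 z.2) ∘L ContinuousLinearMap.fst ℝ E E := by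
  have hz' := TangentBundle.mem_extChartAt_target.1 hz
  refine ContinuousLinearMap.ext fun ζ => ?_
  let B : TangentBundle 𝓘(ℝ, E) Q → E →L[ℝ] ℝ := fun y => g.inner y.proj y.snd
  change B ((extChartAt 𝓘(ℝ, E).tangent x).symm z) _ = B ⟨_, chartSymmDeriv x.proj z.1 z.2⟩
    (chartSymmDeriv x.proj z.1 ζ.1)
  rw [← TangentBundle.extChartAt_symm_apply hz']
  exact congrArg (B _) (tangentProj_comp_mfderiv_symm hz' ζ)

theorem contDiffOn_oneFormInChart_cartanForm [FiniteDimensional ℝ E]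
    (x : TangentBundle 𝓘(ℝ, E) Q) :
    ContDiffOn ℝ ∞ (oneFormInChart 𝓘(ℝ, E).tangent (cartanForm g) x)
      (extChartAt 𝓘(ℝ, E).tangent x).target := by
  refine ContDiffOn.congr ?_ fun z hz => oneFormInChart_cartanForm g hz
  have h1 : ContDiffOn ℝ ∞ (fun z : E × E => metricInChart g x.proj z.1)
      (extChartAt 𝓘(ℝ, E).tangent x).target :=
    (contDiffOn_metricInChart g x.proj).comp contDiff_fst.contDiffOn
      fun z hz => TangentBundle.mem_extChartAt_target.1 hz
  exact (h1.clm_apply contDiffOn_snd).clm_comp contDiffOn_const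

theorem bilinDirDeriv_zero (B : E → E →L[ℝ] E →L[ℝ] ℝ) (y : E) : bilinDirDeriv B y 0 = 0 :=
  ContinuousLinearMap.map_zero _

/-- The velocity `v` of a tangent vector `v` as an element of the model space. -/
def velocity (x : TangentBundle 𝓘(ℝ, E) Q) : E :=
  x.snd

theorem DifferentiableAt.hasFDerivAt_apply_prod {G : Type*} [NormedAddCommGroup G]
    [NormedSpace ℝ G] {B : E → E →L[ℝ] G} {y : E} (hB : DifferentiableAt ℝ B y) (v : E) :
    HasFDerivAt (fun z : E × E => B z.1 z.2) ((B y).comp (ContinuousLinearMap.snd ℝ E E) +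
      (fderiv ℝ B y ∘L ContinuousLinearMap.fst ℝ E E).flip v) (y, v) := by
  have h : HasFDerivAt (fun z : E × E => B z.1) _ (y, v) :=
    hB.hasFDerivAt.comp (y, v) (hasFDerivAt_fst (𝕜 := ℝ) (E := E) (F := E))
  exact h.clm_apply hasFDerivAt_snd

theorem fderiv_bilin_apply_comp_fst {B : E → E →L[ℝ] E →L[ℝ] ℝ} {y : E}
    (hB : DifferentiableAt ℝ B y) (v : E) (ζ χ : E × E) :
    fderiv ℝ (fun z : E × E => (B z.1 z.2) ∘L ContinuousLinearMap.fst ℝ E E) (y, v) ζ χ =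
      bilinDirDeriv B y ζ.1 v χ.1 + B y ζ.2 χ.1 := by
  have h := (hB.hasFDerivAt_apply_prod v).clm_comp
    (hasFDerivAt_const (ContinuousLinearMap.fst ℝ E E) (y, v))
  rw [h.fderiv]
  simp [bilinDirDeriv, add_comm]

theorem fderiv_oneFormInChart_cartanForm [FiniteDimensional ℝ E] (x : TangentBundle 𝓘(ℝ, E) Q)
    (ζ χ : E × E) :
    fderiv ℝ (oneFormInChart 𝓘(ℝ, E).tangent (cartanForm g) x)
      (extChartAt 𝓘(ℝ, E).tangent x x) ζ χ =
      bilinDirDeriv (metricInChart g x.proj) (extChartAt 𝓘(ℝ, E) x.proj x.proj)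
        ζ.1 (velocity x) χ.1 + metricAt g x.proj ζ.2 χ.1 := by
  have heq : oneFormInChart 𝓘(ℝ, E).tangent (cartanForm g) x
      =ᶠ[𝓝 (extChartAt 𝓘(ℝ, E).tangent x x)]
      fun z => (metricInChart g x.proj z.1 z.2) ∘L ContinuousLinearMap.fst ℝ E E := by
    filter_upwards [extChartAt_target_mem_nhds x] with z hz using oneFormInChart_cartanForm g hz
  rw [heq.fderiv_eq, show extChartAt 𝓘(ℝ, E).tangent x x =
      (extChartAt 𝓘(ℝ, E) x.proj x.proj, velocity x) from TangentBundle.extChartAt_self x,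
    fderiv_bilin_apply_comp_fst (((contDiffOn_metricInChart g x.proj).contDiffAt
      (extChartAt_target_mem_nhds x.proj)).differentiableAt (by simp)), metricInChart_self]

theorem oneFormExtDeriv_cartanForm_apply [FiniteDimensional ℝ E] (x : TangentBundle 𝓘(ℝ, E) Q)
    (ξ η : TangentSpace 𝓘(ℝ, E).tangent x) :
    oneFormExtDeriv 𝓘(ℝ, E).tangent (cartanForm g) x ξ η =
      (bilinDirDeriv (metricInChart g x.proj) (extChartAt 𝓘(ℝ, E) x.proj x.proj)
          (ξ : E × E).1 (velocity x) (η : E × E).1 + metricAt g x.proj (ξ : E × E).2 (η : E × E).1) -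
        (bilinDirDeriv (metricInChart g x.proj) (extChartAt 𝓘(ℝ, E) x.proj x.proj)
          (η : E × E).1 (velocity x) (ξ : E × E).1 + metricAt g x.proj (η : E × E).2 (ξ : E × E).1) := by
  let P : E × E →L[ℝ] E × E :=
    mfderiv 𝓘(ℝ, E).tangent 𝓘(ℝ, E × E) (extChartAt 𝓘(ℝ, E).tangent x) x
  have hself : P = ContinuousLinearMap.id ℝ (E × E) :=
    mfderiv_extChartAt_self (I := 𝓘(ℝ, E).tangent) (x := x)
  let D : E × E →L[ℝ] E × E →L[ℝ] ℝ :=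
    fderiv ℝ (oneFormInChart 𝓘(ℝ, E).tangent (cartanForm g) x) (extChartAt 𝓘(ℝ, E).tangent x x)
  change D (P ξ) (P η) - D (P η) (P ξ) = _
  rw [hself]
  exact congrArg₂ (· - ·) (fderiv_oneFormInChart_cartanForm g x ξ η)
    (fderiv_oneFormInChart_cartanForm g x η ξ)

theorem metric_eq_zero_of_inner_self {q : Q} {w : TangentSpace 𝓘(ℝ, E) q}
    (h : g.inner q w w = 0) : w = 0 := by
  by_contra hw
  exact (g.pos q w hw).ne' h

theorem metric_isInvertible [FiniteDimensional ℝ E] (q : Q) : (g.inner q).IsInvertible :=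
  isInvertible_of_separatingLeft (F := E) (g.inner q) fun v hv =>
    metric_eq_zero_of_inner_self g (q := q) (hv v)

/-- For `ξ = (a, b)`, pairing with the vertical vector `(0, a)` leaves `-𝒢(a, a)`. Once `a = 0`,
pairing with `(b, 0)` leaves `𝒢(b, b)`. -/
theorem oneFormExtDeriv_cartanForm_nondegenerate [FiniteDimensional ℝ E]
    (x : TangentBundle 𝓘(ℝ, E) Q) (ξ : TangentSpace 𝓘(ℝ, E).tangent x)
    (h : ∀ η, oneFormExtDeriv 𝓘(ℝ, E).tangent (cartanForm g) x ξ η = 0) : ξ = 0 := by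
  obtain ⟨a, b⟩ : E × E := ξ
  have ha : a = 0 := by
    have h1 := (oneFormExtDeriv_cartanForm_apply g x (a, b) ((0 : E), a)).symm.trans (h ((0 : E), a))
    refine metric_eq_zero_of_inner_self g (q := x.proj) (w := a) (neg_eq_zero.1 ?_)
    simpa [bilinDirDeriv_zero] using! h1
  subst ha
  have hb : b = 0 := by
    have h1 := (oneFormExtDeriv_cartanForm_apply g x (0, b) (b, (0 : E))).symm.trans (h (b, (0 : E)))
    refine metric_eq_zero_of_inner_self g (q := x.proj) (w := b) ?_
    simpa [bilinDirDeriv_zero] using! h1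
  subst hb
  rfl

theorem oneFormExtDeriv_cartanForm_verticalLift [FiniteDimensional ℝ E]
    (x : TangentBundle 𝓘(ℝ, E) Q) (w : TangentSpace 𝓘(ℝ, E) x.proj) :
    oneFormExtDeriv 𝓘(ℝ, E).tangent (cartanForm g) x (verticalLift x w) =
      g.inner x.proj w ∘L tangentProj x := by
  refine ContinuousLinearMap.ext fun η => ?_
  refine (oneFormExtDeriv_cartanForm_apply g x _ η).trans ?_
  rw [verticalLift_apply]
  refine Eq.trans ?_ (congrArg (metricAt g x.proj w) (tangentProj_apply x η)).symm
  simp [bilinDirDeriv_zero]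

/-- The complete lift of the metric at `x`, under the identification of `T_x (TQ)` with `E × E`. -/
theorem completeLift_apply (x : TangentBundle 𝓘(ℝ, E) Q)
    (ξ η : TangentSpace 𝓘(ℝ, E).tangent x) :
    completeLift g x ξ η =
      bilinDirDeriv (metricInChart g x.proj) (extChartAt 𝓘(ℝ, E) x.proj x.proj)
          (velocity x) (ξ : E × E).1 (η : E × E).1 + metricAt g x.proj (ξ : E × E).1 (η : E × E).2 +
        metricAt g x.proj (ξ : E × E).2 (η : E × E).1 := by
  let P : E × E →L[ℝ] E × E :=
    mfderiv 𝓘(ℝ, E).tangent 𝓘(ℝ, E × E) (extChartAt 𝓘(ℝ, E).tangent x) x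
  have hself : P = ContinuousLinearMap.id ℝ (E × E) :=
    mfderiv_extChartAt_self (I := 𝓘(ℝ, E).tangent) (x := x)
  let c : E × E := extChartAt 𝓘(ℝ, E).tangent x x
  have hc : c = (extChartAt 𝓘(ℝ, E) x.proj x.proj, velocity x) := TangentBundle.extChartAt_self x
  change bilinDirDeriv (metricInChart g x.proj) c.1 c.2 (P ξ).1 (P η).1 +
    metricInChart g x.proj c.1 (P ξ).1 (P η).2 + metricInChart g x.proj c.1 (P ξ).2 (P η).1 = _
  rw [hself, hc]
  exact congrArg₂ (· + ·) (congrArg₂ (· + ·) rfl (congrArg (fun B : E →L[ℝ] E →L[ℝ] ℝ => B _ _) (metricInChart_self g _)))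
    (congrArg (fun B : E →L[ℝ] E →L[ℝ] ℝ => B _ _) (metricInChart_self g _))

/-- A vertical vector has no `dq` component, so the derivative of the metric drops out. Hence `𝒢ᶜ`
and `dθ = -ω_L` have the same flat map on vertical vectors. -/
theorem completeLift_verticalLift (x : TangentBundle 𝓘(ℝ, E) Q)
    (w : TangentSpace 𝓘(ℝ, E) x.proj) :
    completeLift g x (verticalLift x w) = g.inner x.proj w ∘L tangentProj x := by
  refine ContinuousLinearMap.ext fun η => ?_
  refine (completeLift_apply g x _ η).trans ?_
  rw [verticalLift_apply]
  refine Eq.trans ?_ (congrArg (metricAt g x.proj w) (tangentProj_apply x η)).symm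
  simp

theorem completeLift_isInvertible [FiniteDimensional ℝ E] (x : TangentBundle 𝓘(ℝ, E) Q) :
    (completeLift g x).IsInvertible := by
  refine isInvertible_of_separatingLeft (F := E × E) (completeLift g x) ?_
  rintro ⟨a, b⟩ h
  have ha : a = 0 := by
    have h1 := (completeLift_apply g x (a, b) ((0 : E), a)).symm.trans (h ((0 : E), a))
    refine metric_eq_zero_of_inner_self g (q := x.proj) (w := a) ?_
    simpa [bilinDirDeriv_zero] using! h1
  subst ha
  have hb : b = 0 := by
    have h1 := (completeLift_apply g x (0, b) (b, (0 : E))).symm.trans (h (b, (0 : E)))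
    refine metric_eq_zero_of_inner_self g (q := x.proj) (w := b) ?_
    simpa [bilinDirDeriv_zero] using! h1
  subst hb
  rfl

end CartanForm

/-! ### Topology of the tangent bundle -/

section TangentBundleTopology

variable {E : Type*} [NormedAddCommGroup E] [NormedSpace ℝ E]
  {Q : Type*} [TopologicalSpace Q] [ChartedSpace E Q] [IsManifold 𝓘(ℝ, E) ∞ Q]

/-- Vectors over different points are separated by the projection, vectors in one fibre by a
trivialization. -/
theorem TangentBundle.t2Space [T2Space Q] : T2Space (TangentBundle 𝓘(ℝ, E) Q) := by
  refine ⟨fun x y hxy => ?_⟩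
  have hc := FiberBundle.continuous_proj E (TangentSpace 𝓘(ℝ, E) : Q → Type _)
  by_cases hp : x.proj = y.proj
  · let e := trivializationAt E (TangentSpace 𝓘(ℝ, E) : Q → Type _) x.proj
    have hx : x ∈ e.source := e.mem_source.2 (FiberBundle.mem_baseSet_trivializationAt' x.proj)
    have hy : y ∈ e.source :=
      e.mem_source.2 (hp ▸ FiberBundle.mem_baseSet_trivializationAt' x.proj)
    obtain ⟨U, W, hU, hW, hxU, hyW, hUW⟩ := t2_separation (e.injOn.ne hx hy hxy)
    refine ⟨e.source ∩ e ⁻¹' U, e.source ∩ e ⁻¹' W,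
      e.continuousOn.isOpen_inter_preimage e.open_source hU,
      e.continuousOn.isOpen_inter_preimage e.open_source hW, ⟨hx, hxU⟩, ⟨hy, hyW⟩, ?_⟩
    exact (hUW.preimage e).mono inter_subset_right inter_subset_right
  · obtain ⟨U, W, hU, hW, hxU, hyW, hUW⟩ := t2_separation hp
    exact ⟨_, _, hU.preimage hc, hW.preimage hc, hxU, hyW, hUW.preimage _⟩

theorem TangentBundle.secondCountableTopology [FiniteDimensional ℝ E]
    [SecondCountableTopology Q] : SecondCountableTopology (TangentBundle 𝓘(ℝ, E) Q) := by
  have : SecondCountableTopology E := inferInstance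
  obtain ⟨s, hs, hsc⟩ := TopologicalSpace.countable_cover_nhds
    fun q : Q => (chartAt E q).open_source.mem_nhds (mem_chart_source E q)
  have : SecondCountableTopology (ModelProd E E) :=
    inferInstanceAs (SecondCountableTopology (E × E))
  refine ChartedSpace.secondCountable_of_countable_cover (ModelProd E E)
    (s := (fun q : Q => (⟨q, (0 : E)⟩ : TangentBundle 𝓘(ℝ, E) Q)) '' s) ?_ (hs.image _)
  refine eq_univ_of_forall fun x => ?_
  obtain ⟨q, hq, hxq⟩ := mem_iUnion₂.1 (hsc ▸ mem_univ x.proj)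
  exact mem_iUnion₂.2 ⟨_, mem_image_of_mem _ hq,
    (TangentBundle.mem_chart_source_iff (I := 𝓘(ℝ, E)) _ _).2 hxq⟩

/-- Needed for partitions of unity on `TQ`. -/
theorem TangentBundle.sigmaCompactSpace [FiniteDimensional ℝ E]
    [SecondCountableTopology Q] : SigmaCompactSpace (TangentBundle 𝓘(ℝ, E) Q) := by
  have := TangentBundle.secondCountableTopology (E := E) (Q := Q)
  have : LocallyCompactSpace (ModelProd E E) := inferInstanceAs (LocallyCompactSpace (E × E))
  have := ChartedSpace.locallyCompactSpace (ModelProd E E) (TangentBundle 𝓘(ℝ, E) Q)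
  infer_instance

end TangentBundleTopology

/-! ### Mechanical Lagrangians -/

namespace MechanicalControlSystem

set_option linter.unusedSectionVars false
set_option synthInstance.maxHeartbeats 100000

variable {E : Type*} [NormedAddCommGroup E] [NormedSpace ℝ E]
  {Q : Type*} [TopologicalSpace Q] [ChartedSpace E Q] [IsManifold 𝓘(ℝ, E) ∞ Q] {m : ℕ}
  (S : MechanicalControlSystem E Q m)

theorem contMDiff_kinetic : ContMDiff 𝓘(ℝ, E).tangent 𝓘(ℝ, ℝ) ∞
    (fun x : TangentBundle 𝓘(ℝ, E) Q => 1 / 2 * S.metric.inner x.proj x.snd x.snd) := by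
  have h := contMDiffOn_univ.1 (contMDiffOn_metric_inner S.metric (I := 𝓘(ℝ, E).tangent)
    (b := fun x : TangentBundle 𝓘(ℝ, E) Q => x.proj) (v := fun x => x.snd) (w := fun x => x.snd)
    (s := univ) contMDiffOn_id contMDiffOn_id)
  exact contMDiff_const.mul h

theorem contMDiff_potential_proj : ContMDiff 𝓘(ℝ, E).tangent 𝓘(ℝ, ℝ) ∞
    (fun x : TangentBundle 𝓘(ℝ, E) Q => S.potential x.proj) :=
  S.potential_smooth.comp TangentBundle.contMDiff_proj

theorem contMDiff_lagrangian : ContMDiff 𝓘(ℝ, E).tangent 𝓘(ℝ, ℝ) ∞ S.lagrangian :=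
  S.contMDiff_kinetic.sub S.contMDiff_potential_proj

/-- On a fibre `L` is a quadratic form minus a constant; the symmetry of `𝒢` absorbs the factor
`1/2`. -/
theorem functionDifferential_lagrangian_verticalLift (x : TangentBundle 𝓘(ℝ, E) Q)
    (w : TangentSpace 𝓘(ℝ, E) x.proj) :
    functionDifferential S.lagrangian x (verticalLift x w) = S.metric.inner x.proj x.snd w := by
  let v : E := x.snd
  have hi := (TangentBundle.contMDiff_fibre_inclusion x.proj v).mdifferentiableAt (by simp)
  have hL := (S.contMDiff_lagrangian (⟨x.proj, v⟩ : TangentBundle 𝓘(ℝ, E) Q)).mdifferentiableAt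
    (by simp)
  have h1 := mfderiv_comp v hL hi
  let B : E →L[ℝ] E →L[ℝ] ℝ := metricAt S.metric x.proj
  have hsymm : ∀ a b, B a b = B b a := S.metric.symm x.proj
  have heq : S.lagrangian ∘ (fun w : E => (⟨x.proj, w⟩ : TangentBundle 𝓘(ℝ, E) Q)) =
      fun w => 1 / 2 * B w w - S.potential x.proj := rfl
  have hd : HasFDerivAt (fun w : E => 1 / 2 * B w w - S.potential x.proj) (B v) v := by
    have h2 := ((B.hasFDerivAt (x := v)).clm_apply (hasFDerivAt_id v)).const_mul (1 / 2 : ℝ)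
    refine (h2.sub_const (S.potential x.proj)).congr_fderiv ?_
    ext u
    have := hsymm u v
    simp only [smul_add, add_apply, smul_apply, ContinuousLinearMap.comp_apply,
      ContinuousLinearMap.id_apply, ContinuousLinearMap.flip_apply, smul_eq_mul, id]
    linarith
  rw [heq, mfderiv_eq_fderiv, hd.fderiv] at h1
  exact (DFunLike.congr_fun h1 w).symm

theorem functionDifferential_lagrangian_comp_almostTangent :
    (fun y => functionDifferential S.lagrangian y ∘L almostTangent y) = cartanForm S.metric := by
  funext y
  exact ContinuousLinearMap.ext fun ξ =>
    S.functionDifferential_lagrangian_verticalLift y (tangentProj y ξ)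

theorem energy_lagrangian : energy S.lagrangian = fun x =>
    1 / 2 * S.metric.inner x.proj x.snd x.snd + S.potential x.proj := by
  funext x
  rw [energy, functionDifferential_lagrangian_verticalLift, lagrangian]
  ring

theorem contMDiff_energy : ContMDiff 𝓘(ℝ, E).tangent 𝓘(ℝ, ℝ) ∞ (energy S.lagrangian) := by
  rw [energy_lagrangian]
  exact S.contMDiff_kinetic.add S.contMDiff_potential_proj

theorem lagrangianForm_eq (x : TangentBundle 𝓘(ℝ, E) Q) :
    lagrangianForm S.lagrangian x =
      -oneFormExtDeriv 𝓘(ℝ, E).tangent (cartanForm S.metric) x := by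
  rw [lagrangianForm, functionDifferential_lagrangian_comp_almostTangent]

variable [FiniteDimensional ℝ E]

theorem lagrangianForm_isInvertible (x : TangentBundle 𝓘(ℝ, E) Q) :
    (lagrangianForm S.lagrangian x).IsInvertible := by
  refine isInvertible_of_separatingLeft (F := E × E) (lagrangianForm S.lagrangian x) fun ξ h => ?_
  rw [lagrangianForm_eq] at h
  exact oneFormExtDeriv_cartanForm_nondegenerate S.metric x ξ fun η => neg_eq_zero.1 (h η)

theorem lagrangianForm_eulerLagrangeField (x : TangentBundle 𝓘(ℝ, E) Q) :
    lagrangianForm S.lagrangian x (eulerLagrangeField S.lagrangian x) =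
      functionDifferential (energy S.lagrangian) x :=
  (S.lagrangianForm_isInvertible x).self_apply_inverse _

theorem metric_controlField (a : Fin m) (q : Q) :
    S.metric.inner q (S.controlField a q) = S.force a q :=
  (metric_isInvertible S.metric q).self_apply_inverse _

/-- The minus sign is that of `ω_L = -dθ`; it is the source of the sign in `-τ*_a (f^a)ⱽ`. -/
theorem lagrangianForm_vectorVerticalLift (a : Fin m) (x : TangentBundle 𝓘(ℝ, E) Q) :
    lagrangianForm S.lagrangian x (vectorVerticalLift (S.controlField a) x) =
      -oneFormVerticalLift (S.force a) x := by
  rw [lagrangianForm_eq, vectorVerticalLift, oneFormVerticalLift, ← metric_controlField]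
  exact congrArg Neg.neg (oneFormExtDeriv_cartanForm_verticalLift S.metric x _)

theorem completeLift_vectorVerticalLift (a : Fin m) (x : TangentBundle 𝓘(ℝ, E) Q) :
    completeLift S.metric x (vectorVerticalLift (S.controlField a) x) =
      oneFormVerticalLift (S.force a) x := by
  rw [vectorVerticalLift, completeLift_verticalLift, metric_controlField, oneFormVerticalLift]

theorem sharp_completeLift_oneFormVerticalLift (a : Fin m) (x : TangentBundle 𝓘(ℝ, E) Q) :
    sharp (completeLift S.metric x) (oneFormVerticalLift (S.force a) x) =
      vectorVerticalLift (S.controlField a) x := by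
  rw [← completeLift_vectorVerticalLift]
  exact (completeLift_isInvertible S.metric x).inverse_apply_self _

theorem liftedInputDistribution_eq_span (x : TangentBundle 𝓘(ℝ, E) Q) :
    S.liftedInputDistribution x =
      Submodule.span ℝ (range fun a => vectorVerticalLift (S.controlField a) x) := by
  rw [liftedInputDistribution, inputDistribution, Submodule.map_span, ← range_comp]
  rfl

theorem map_completeLift_liftedInputDistribution (x : TangentBundle 𝓘(ℝ, E) Q) :
    (S.liftedInputDistribution x).map (completeLift S.metric x).toLinearMap =
      Submodule.span ℝ (range fun a =>
        completeLift S.metric x (vectorVerticalLift (S.controlField a) x)) := by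
  rw [liftedInputDistribution_eq_span, Submodule.map_span, ← range_comp]
  rfl

/-- The contribution of `G` cancels `dE_L`, leaving only the forces. -/
theorem chetaevForm_closedLoopField (u : TangentBundle 𝓘(ℝ, E) Q → Fin m → ℝ)
    (x : TangentBundle 𝓘(ℝ, E) Q) :
    S.chetaevForm (S.closedLoopField u) x =
      -∑ a, u x a • oneFormVerticalLift (S.force a) x := by
  rw [chetaevForm, closedLoopField, map_add, lagrangianForm_eulerLagrangeField, map_sum,
    add_sub_cancel_left, ← Finset.sum_neg_distrib]
  exact Finset.sum_congr rfl fun a _ => by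
    rw [map_smul, lagrangianForm_vectorVerticalLift, smul_neg]

/-! ### Smoothness of the closed-loop vector field -/

theorem contDiffOn_oneFormInChart_functionDifferential {f : TangentBundle 𝓘(ℝ, E) Q → ℝ}
    (hf : ContMDiff 𝓘(ℝ, E).tangent 𝓘(ℝ, ℝ) ∞ f) (x : TangentBundle 𝓘(ℝ, E) Q) :
    ContDiffOn ℝ ∞ (oneFormInChart 𝓘(ℝ, E).tangent (functionDifferential f) x)
      (extChartAt 𝓘(ℝ, E).tangent x).target := by
  have h1 : ContDiffOn ℝ ∞ (f ∘ (extChartAt 𝓘(ℝ, E).tangent x).symm)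
      (extChartAt 𝓘(ℝ, E).tangent x).target :=
    contMDiffOn_iff_contDiffOn.1 (hf.comp_contMDiffOn (contMDiffOn_extChartAt_symm x))
  refine (h1.fderiv_of_isOpen (m := ∞) (isOpen_extChartAt_target x) (by simp)).congr fun z hz => ?_
  have h2 := mfderiv_comp z ((hf _).mdifferentiableAt (by simp))
    (mdifferentiableAt_extChartAt_symm (I := 𝓘(ℝ, E).tangent) hz)
  rw [mfderiv_eq_fderiv] at h2
  exact h2.symm

theorem contDiffOn_oneFormInChart_oneFormVerticalLift (a : Fin m)
    (x : TangentBundle 𝓘(ℝ, E) Q) :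
    ContDiffOn ℝ ∞ (oneFormInChart 𝓘(ℝ, E).tangent (oneFormVerticalLift (S.force a)) x)
      (extChartAt 𝓘(ℝ, E).tangent x).target := by
  refine contDiffOn_clm_apply.2 fun ζ => ?_
  let f : E → ℝ := fun y => S.force a ((extChartAt 𝓘(ℝ, E) x.proj).symm y)
    (chartSymmDeriv x.proj y ζ.1)
  have hf : ContDiffOn ℝ ∞ f (extChartAt 𝓘(ℝ, E) x.proj).target := by
    refine contMDiffOn_iff_contDiffOn.1 fun y hy => ?_
    have hv := TangentBundle.contMDiffOn_extChartAt_symm_mk x.proj ζ.1 y hy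
    have : ContMDiffWithinAt 𝓘(ℝ, E) (𝓘(ℝ, E).prod 𝓘(ℝ, ℝ)) ∞
        (fun y => TotalSpace.mk' ℝ (E := Bundle.Trivial Q ℝ)
          ((extChartAt 𝓘(ℝ, E) x.proj).symm y) (f y)) (extChartAt 𝓘(ℝ, E) x.proj).target y := by
      apply ContMDiffWithinAt.clm_bundle_apply (F₁ := E)
        (E₁ := (TangentSpace 𝓘(ℝ, E) : Q → Type _))
      · exact ContMDiffAt.comp_contMDiffWithinAt y (S.force_smooth a).contMDiffAt
          ((TangentBundle.contMDiff_proj _).comp_contMDiffWithinAt y hv)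
      · exact hv
    exact (contMDiffWithinAt_totalSpace.1 this).2
  refine (hf.comp contDiff_fst.contDiffOn fun z hz =>
    TangentBundle.mem_extChartAt_target.1 hz).congr fun z hz => ?_
  exact congrArg (S.force a ((extChartAt 𝓘(ℝ, E) x.proj).symm z.1))
    (tangentProj_comp_mfderiv_symm (TangentBundle.mem_extChartAt_target.1 hz) ζ)

/-- The lift solves `i_X dθ = (f^a)ⱽ`, so it is smooth for the same reason as `G`; smoothness of
`♯_𝒢` is not treated separately. -/
theorem contMDiff_vectorVerticalLift (a : Fin m) :
    ContMDiff 𝓘(ℝ, E).tangent 𝓘(ℝ, E).tangent.tangent ∞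
      (fun x => (⟨x, vectorVerticalLift (S.controlField a) x⟩ :
        TangentBundle 𝓘(ℝ, E).tangent (TangentBundle 𝓘(ℝ, E) Q))) := by
  refine contMDiff_of_oneFormExtDeriv_eq (contDiffOn_oneFormInChart_cartanForm S.metric)
    (S.contDiffOn_oneFormInChart_oneFormVerticalLift a)
    (oneFormExtDeriv_cartanForm_nondegenerate S.metric) fun x => ?_
  have h := S.lagrangianForm_vectorVerticalLift a x
  rw [lagrangianForm_eq] at h
  exact neg_injective h

theorem contMDiff_eulerLagrangeField :
    ContMDiff 𝓘(ℝ, E).tangent 𝓘(ℝ, E).tangent.tangent ∞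
      (fun x => (⟨x, eulerLagrangeField S.lagrangian x⟩ :
        TangentBundle 𝓘(ℝ, E).tangent (TangentBundle 𝓘(ℝ, E) Q))) := by
  -- Because `ω_L = -dθ`, the right-hand side of the equation for `dθ` is `d(-E_L)`.
  refine contMDiff_of_oneFormExtDeriv_eq (contDiffOn_oneFormInChart_cartanForm S.metric)
    (β := functionDifferential (-energy S.lagrangian))
    (contDiffOn_oneFormInChart_functionDifferential S.contMDiff_energy.neg)
    (oneFormExtDeriv_cartanForm_nondegenerate S.metric) fun x => ?_
  have h := S.lagrangianForm_eulerLagrangeField x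
  rw [lagrangianForm_eq] at h
  refine (neg_eq_iff_eq_neg.1 h).trans ?_
  exact mfderiv_neg.symm

theorem contMDiff_closedLoopField {u : TangentBundle 𝓘(ℝ, E) Q → Fin m → ℝ}
    (hu : ContMDiff 𝓘(ℝ, E).tangent 𝓘(ℝ, Fin m → ℝ) ∞ u) :
    ContMDiff 𝓘(ℝ, E).tangent 𝓘(ℝ, E).tangent.tangent ∞
      (fun x => (⟨x, S.closedLoopField u x⟩ :
        TangentBundle 𝓘(ℝ, E).tangent (TangentBundle 𝓘(ℝ, E) Q))) := by
  refine ContMDiff.add_section S.contMDiff_eulerLagrangeField ?_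
  refine ContMDiff.sum_section fun a _ => ?_
  exact ContMDiff.smul_section (contMDiff_pi_space.1 hu a) (S.contMDiff_vectorVerticalLift a)

end MechanicalControlSystem

end

theorem mainTheorem1
    {E : Type*} [NormedAddCommGroup E] [NormedSpace ℝ E] [FiniteDimensional ℝ E]
    {Q : Type*} [TopologicalSpace Q] [T2Space Q] [SecondCountableTopology Q]
    [ChartedSpace E Q] [IsManifold 𝓘(ℝ, E) ∞ Q]
    {m : ℕ} (S : MechanicalControlSystem E Q m)
    (M : Set (TangentBundle 𝓘(ℝ, E) Q))
    (hM : IsClosedSubmanifold 𝓘(ℝ, E).tangent m M)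
    (htrans : ∀ x ∈ M,
      Transversal (submanifoldTangentSpace 𝓘(ℝ, E).tangent M x) (S.liftedInputDistribution x)) :
    -- the Euler-Lagrange vector field is well defined
    (∀ x, lagrangianForm S.lagrangian x (eulerLagrangeField S.lagrangian x) =
      functionDifferential (energy S.lagrangian) x) ∧
    -- there is a unique control law
    (∃! τ : M → Fin m → ℝ, S.IsControlLaw M τ) ∧
    -- and it characterizes the closed-loop vector fields leaving the constraint invariant
    (∀ τ : M → Fin m → ℝ, S.IsControlLaw M τ →
      ∀ u : TangentBundle 𝓘(ℝ, E) Q → Fin m → ℝ,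
        ContMDiff 𝓘(ℝ, E).tangent 𝓘(ℝ, Fin m → ℝ) ∞ u →
        List.TFAE [
          IsFlowInvariant 𝓘(ℝ, E).tangent (S.closedLoopField u) M,
          ∀ x : M,
            S.chetaevForm (S.closedLoopField u) x =
              -∑ a, τ x a • oneFormVerticalLift (S.force a) (x : TangentBundle 𝓘(ℝ, E) Q) ∧
            S.closedLoopField u x ∈ submanifoldTangentSpace 𝓘(ℝ, E).tangent M x,
          ∀ x : M,
            S.chetaevForm (S.closedLoopField u) x ∈
              (S.liftedInputDistribution x).map (completeLift S.metric x).toLinearMap ∧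
            S.closedLoopField u x ∈ submanifoldTangentSpace 𝓘(ℝ, E).tangent M x]) ∧
    -- the lifted input distribution and its image under the flat map of the complete lift
    (∀ x : TangentBundle 𝓘(ℝ, E) Q,
      S.liftedInputDistribution x = Submodule.span ℝ (range fun a =>
        sharp (completeLift S.metric x) (oneFormVerticalLift (S.force a) x)) ∧
      (S.liftedInputDistribution x).map (completeLift S.metric x).toLinearMap =
        Submodule.span ℝ (range fun a =>
          completeLift S.metric x (vectorVerticalLift (S.controlField a) x)) ∧
      (S.liftedInputDistribution x).map (completeLift S.metric x).toLinearMap =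
        Submodule.span ℝ (range fun a => oneFormVerticalLift (S.force a) x)) := by

  have : T2Space (TangentBundle 𝓘(ℝ, E) Q) := TangentBundle.t2Space
  have : SigmaCompactSpace (TangentBundle 𝓘(ℝ, E) Q) := TangentBundle.sigmaCompactSpace
  have hsup : ∀ x ∈ M, submanifoldTangentSpace 𝓘(ℝ, E).tangent M x ⊔ Submodule.span ℝ
      (range fun a => vectorVerticalLift (S.controlField a) x) = ⊤ := fun x hx => by
    rw [← S.liftedInputDistribution_eq_span]
    exact (htrans x hx).1
  have hinv : ∀ {u : TangentBundle 𝓘(ℝ, E) Q → Fin m → ℝ},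
      ContMDiff 𝓘(ℝ, E).tangent 𝓘(ℝ, Fin m → ℝ) ∞ u →
      (IsFlowInvariant 𝓘(ℝ, E).tangent (S.closedLoopField u) M ↔
        ∀ x ∈ M, S.closedLoopField u x ∈ submanifoldTangentSpace 𝓘(ℝ, E).tangent M x) :=
    fun hu => isFlowInvariant_iff hM (S.contMDiff_closedLoopField hu)
  have hunique : ∀ {u v : TangentBundle 𝓘(ℝ, E) Q → Fin m → ℝ}, ∀ x ∈ M,
      S.closedLoopField u x ∈ submanifoldTangentSpace 𝓘(ℝ, E).tangent M x →
      S.closedLoopField v x ∈ submanifoldTangentSpace 𝓘(ℝ, E).tangent M x → u x = v x :=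
    fun x hx hu hv =>
      (existsUnique_feedback (G := eulerLagrangeField S.lagrangian)
        (Y := fun a => vectorVerticalLift (S.controlField a)) hM hx (hsup x hx)).unique hu hv
  refine ⟨S.lagrangianForm_eulerLagrangeField, ?_, ?_, fun x => ⟨?_, ?_, ?_⟩⟩
  · obtain ⟨u, hu, hut⟩ := exists_contMDiff_feedback hM S.contMDiff_eulerLagrangeField
      S.contMDiff_vectorVerticalLift hsup
    refine ⟨fun x => u x, ⟨u, hu, fun _ => rfl, (hinv hu).2 hut⟩, ?_⟩
    rintro τ ⟨v, hv, hvτ, hvi⟩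
    funext x
    rw [← hvτ x]
    exact hunique x x.2 ((hinv hv).1 hvi x x.2) (hut x x.2)
  · rintro τ ⟨v, hv, hvτ, hvi⟩ u hu
    -- Both `u` and a feedback `v` extending `τ` are tangent along `M`, so pointwise uniqueness
    -- gives `u = v = τ` there.
    tfae_have 1 → 2 := fun h x => by
      have ht := (hinv hu).1 h x x.2
      refine ⟨?_, ht⟩
      rw [S.chetaevForm_closedLoopField, ← hvτ x, hunique x x.2 ht ((hinv hv).1 hvi x x.2)]
    tfae_have 2 → 3 := fun h x => by
      refine ⟨?_, (h x).2⟩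
      rw [(h x).1, S.map_completeLift_liftedInputDistribution]
      simp only [S.completeLift_vectorVerticalLift]
      exact neg_mem (Submodule.sum_mem _ fun a _ =>
        Submodule.smul_mem _ _ (Submodule.subset_span (mem_range_self a)))
    -- Tangency alone gives invariance; the condition on the form holds for every closed-loop field.
    tfae_have 3 → 1 := fun h => (hinv hu).2 fun x hx => (h ⟨x, hx⟩).2
    tfae_finish
  · simp only [S.sharp_completeLift_oneFormVerticalLift]
    exact S.liftedInputDistribution_eq_span x
  · exact S.map_completeLift_liftedInputDistribution x
  · rw [S.map_completeLift_liftedInputDistribution]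
    simp only [S.completeLift_vectorVerticalLift]
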